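/- Let $h_5(x)=\frac{4x^5-20x^3+15x}{2\pi^{1/4}\sqrt{15}}$ (the fifth Hermite polynomial, normalized with respect to the weight $e^{-x^2}$). For $\eta\in[0,1)$ let $f_\eta:\mathbb{R}^2\to\{-1,1\}$ be given by $f_\eta(x_1,x_2)=1$ if $x_2\ge \eta h_5(x_1)$ and $f_\eta(x_1,x_2)=-1$ otherwise. For $z$ in the strip $S=\{z\in\mathbb{C}: |\Re z|<1\}$ put $$H_\eta(z)=\frac{1}{2\pi(1-z^2)}\int_{\mathbb{R}^2\times\mathbb{R}^2} f_\eta(x)f_\eta(y)\exp\left(\frac{-\|x\|_2^2-\|y\|_2^2+2z\langle x,y\rangle}{1-z^2}\right)dx\,dy,$$ and for $p\in[0,1]$ put $F_p=F_{p,\eta}=(1-p)H_0+pH_\eta$. Let $\mathbb{D}$ be the open unit disc in $\mathbb{C}$. There exists $\eta_0\in(0,1]$ such that for every $\eta\in(0,\eta_0)$ the number $H_\eta(i)/i$ is real and larger than $\log(1+\sqrt2)$, and there exists $p_0\in(0,1]$ (depending on $\eta$) such that for every $p\in(0,p_0)$ the following hold. 1. $F_p(S)\supseteq \frac{9}{10}\mathbb{D}$,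 and $F_p^{-1}$ is well defined and analytic on $\frac{9}{10}\mathbb{D}$, in the following sense: there is a bounded open set $\Omega\ni 0$ with $\overline{\Omega}\subseteq S$ such that $F_p$ maps $\Omega$ bijectively onto $\frac{9}{10}\mathbb{D}$, and the inverse $F_p^{-1}:\frac{9}{10}\mathbb{D}\to\Omega$ of this bijection is analytic and satisfies $F_p^{-1}(0)=0$. 2. Let $F_p^{-1}(z)=\sum_{k=1}^\infty a_k(p)z^k$ be the Taylor expansion on $\frac{9}{10}\mathbb{D}$. Then there exists $\gamma\in[0,\infty)$ with $$\sum_{k=1}^\infty |a_k(p)|\gamma^k=1\qquad\text{and}\qquad \gamma>\log(1+\sqrt2).$$ -/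

import Mathlib

namespace KrivineRounding

noncomputable section

/-- The fifth Hermite polynomial, normalized so that the Hermite polynomials are orthonormal for the
measure on `ℝ` with density `exp (-x ^ 2)`. -/
def h5 (x : ℝ) : ℝ :=
  (4 * x ^ 5 - 20 * x ^ 3 + 15 * x) / (2 * Real.pi ^ (1 / 4 : ℝ) * Real.sqrt 15)

/-- The `±1`-valued function on the plane whose value at `(x₁, x₂)` is `1` exactly when
`x₂ ≥ η * h5 x₁`. -/
def signAbove (η : ℝ) (x : ℝ × ℝ) : ℝ :=
  open Classical in if η * h5 x.1 ≤ x.2 then 1 else -1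

/-- The function `H_η`. The integral is over `ℝ² × ℝ²` with Lebesgue measure; it converges absolutely
for every `z` with `|Re z| < 1`. -/
def H (η : ℝ) (z : ℂ) : ℂ :=
  1 / (2 * (Real.pi : ℂ) * (1 - z ^ 2)) *
    ∫ q : (ℝ × ℝ) × (ℝ × ℝ),
      ((signAbove η q.1 * signAbove η q.2 : ℝ) : ℂ) *
        Complex.exp
          ((-((q.1.1 ^ 2 + q.1.2 ^ 2 : ℝ) : ℂ) - ((q.2.1 ^ 2 + q.2.2 ^ 2 : ℝ) : ℂ)
            + 2 * z * ((q.1.1 * q.2.1 + q.1.2 * q.2.2 : ℝ) : ℂ)) / (1 - z ^ 2))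

/-- The convex combination `F_p = (1 - p) H_0 + p H_η`. -/
def F (η p : ℝ) (z : ℂ) : ℂ :=
  (1 - (p : ℂ)) * H 0 z + (p : ℂ) * H η z

/-- The open vertical strip `|Re z| < 1`. -/
def strip : Set ℂ := {z | |z.re| < 1}

/-- The `k`-th Taylor coefficient at the origin. -/
def taylorCoeff (G : ℂ → ℂ) (k : ℕ) : ℂ :=
  iteratedDeriv k G 0 / (k.factorial : ℂ)

end

end KrivineRounding

/-! Put `L = log (1 + √2)`, so that `sinh L = 1` and `sin (iL) = i`. Grothendieck's identity says
that `H 0` inverts the sine on the unit disc (`H_zero_sin`). In the coordinate `z = sin v` the map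
`F η p` therefore becomes `v + p E(v)` with `E(v) = H η (sin v) - v` (`F_sin`). For small `p` this
is a perturbation of the identity with an analytic inverse (`exists_perturbed_inverse`), and `sin`
composed with that inverse is the required `G`, an odd function within `O(p)` of `sin`.

If the odd coefficients of `G` had the alternating signs of the sine, `∑ |aₖ| Lᵏ` would be exactly
`G(iL)/i`, which to first order is `1 - p cosh L · (H η i / i - L)`. Wrong signs or phases can occur
where `1/k!` is small compared with `p`, but altogether they cost only `o(p)`: a coefficient error
`d` costs at most `min (2|d|) (4|d|² k!)`, and dominated convergence applies. So if `H η i / i > L`,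
the series of absolute values is below `1` at `L`; it is at least `1` at `89/100`, and the
intermediate value theorem gives `γ` (`exists_taylor_norm_root`, `exists_inverse_and_root`).

The inequality `H η i / i > L` comes from expanding `H η i` in `η` (`exists_H_I_expansion`). At `z =
i` the kernel is a Gaussian times a Fourier kernel. The fifth Hermite function is an eigenfunction
of this transform with eigenvalue `i⁵ = i`, which makes the terms of order two cancel. The term of
order four is an explicit Gaussian integral of polynomials and turns out positive; the remainder is
of order `η⁵`. -/

namespace KrivineRounding

open MeasureTheory Filter Topology Set Metric Polynomial

noncomputable section

/-! ### The kernel and the holomorphy of `H η` on the strip -/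

/-- The Gaussian kernel in the definition of `H`. -/
def kern (z : ℂ) (q : (ℝ × ℝ) × (ℝ × ℝ)) : ℂ :=
  Complex.exp ((-((q.1.1 ^ 2 + q.1.2 ^ 2 : ℝ) : ℂ) - ((q.2.1 ^ 2 + q.2.2 ^ 2 : ℝ) : ℂ)
            + 2 * z * ((q.1.1 * q.2.1 + q.1.2 * q.2.2 : ℝ) : ℂ)) / (1 - z ^ 2))

/-- The product of the two signs in the definition of `H`. -/
def signProd (η : ℝ) (q : (ℝ × ℝ) × (ℝ × ℝ)) : ℝ := signAbove η q.1 * signAbove η q.2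

/-- With `S = |x + y|²/2` and `D = |x - y|²/2` the exponent of the kernel splits as `-S/(1+z) -
D/(1-z)`. Convergence on the strip then amounts to `Re (1 ± z) > 0`. -/
def sumPart (q : (ℝ × ℝ) × (ℝ × ℝ)) : ℝ :=
  ((q.1.1 + q.2.1) ^ 2 + (q.1.2 + q.2.2) ^ 2) / 2

def diffPart (q : (ℝ × ℝ) × (ℝ × ℝ)) : ℝ :=
  ((q.1.1 - q.2.1) ^ 2 + (q.1.2 - q.2.2) ^ 2) / 2

def sqNorm (q : (ℝ × ℝ) × (ℝ × ℝ)) : ℝ :=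
  (q.1.1 ^ 2 + q.1.2 ^ 2) + (q.2.1 ^ 2 + q.2.2 ^ 2)

lemma sumPart_nonneg (q) : 0 ≤ sumPart q := by unfold sumPart; positivity

lemma diffPart_nonneg (q) : 0 ≤ diffPart q := by unfold diffPart; positivity

lemma sumPart_add_diffPart (q) : sumPart q + diffPart q = sqNorm q := by
  unfold sumPart diffPart sqNorm; ring

lemma H_eq (η : ℝ) (z : ℂ) : H η z =
    1 / (2 * (Real.pi : ℂ) * (1 - z ^ 2)) * ∫ q, (signProd η q : ℂ) * kern z q := rfl

lemma one_add_ne_zero_of_mem_strip {z : ℂ} (hz : z ∈ strip) : 1 + z ≠ 0 := by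
  intro h
  have := congrArg Complex.re h
  simp only [Complex.add_re, Complex.one_re, Complex.zero_re] at this
  have h2 : |z.re| < 1 := hz
  rw [abs_lt] at h2
  linarith

lemma one_sub_ne_zero_of_mem_strip {z : ℂ} (hz : z ∈ strip) : 1 - z ≠ 0 := by
  intro h
  have := congrArg Complex.re h
  simp only [Complex.sub_re, Complex.one_re, Complex.zero_re] at this
  have h2 : |z.re| < 1 := hz
  rw [abs_lt] at h2
  linarith

lemma one_sub_sq_ne_zero_of_mem_strip {z : ℂ} (hz : z ∈ strip) : 1 - z ^ 2 ≠ 0 := by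
  have : 1 - z ^ 2 = (1 + z) * (1 - z) := by ring
  rw [this]
  exact mul_ne_zero (one_add_ne_zero_of_mem_strip hz) (one_sub_ne_zero_of_mem_strip hz)

lemma isOpen_strip : IsOpen strip :=
  isOpen_lt (Complex.continuous_re.abs) continuous_const

lemma kern_eq {z : ℂ} (hz : z ∈ strip) (q) :
    kern z q = Complex.exp (-(sumPart q : ℂ) * (1 + z)⁻¹ + -(diffPart q : ℂ) * (1 - z)⁻¹) := by
  have h1 := one_add_ne_zero_of_mem_strip hz
  have h2 := one_sub_ne_zero_of_mem_strip hz
  have h3 := one_sub_sq_ne_zero_of_mem_strip hz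
  unfold kern sumPart diffPart
  congr 1
  push_cast
  rw [div_eq_iff h3]
  have : (1 - z ^ 2 : ℂ) = (1 + z) * (1 - z) := by ring
  rw [this]
  field_simp
  ring

lemma norm_kern {z : ℂ} (hz : z ∈ strip) (q) :
    ‖kern z q‖ = Real.exp (-sumPart q * ((1 + z)⁻¹).re + -diffPart q * ((1 - z)⁻¹).re) := by
  rw [kern_eq hz, Complex.norm_exp]
  congr 1
  rw [Complex.add_re, ← Complex.ofReal_neg, ← Complex.ofReal_neg, Complex.re_ofReal_mul,
    Complex.re_ofReal_mul]

lemma inv_re_pos {w : ℂ} (hw : 0 < w.re) : 0 < (w⁻¹).re := by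
  rw [Complex.inv_re]
  refine div_pos hw (Complex.normSq_pos.2 ?_)
  rintro rfl
  simp at hw

lemma norm_kern_le {z : ℂ} (hz : z ∈ strip) {c : ℝ} (h1 : c ≤ ((1 + z)⁻¹).re)
    (h2 : c ≤ ((1 - z)⁻¹).re) (q) : ‖kern z q‖ ≤ Real.exp (-c * sqNorm q) := by
  rw [norm_kern hz, ← sumPart_add_diffPart]
  refine Real.exp_le_exp.2 ?_
  nlinarith [sumPart_nonneg q, diffPart_nonneg q,
    mul_le_mul_of_nonneg_left h1 (sumPart_nonneg q),
    mul_le_mul_of_nonneg_left h2 (diffPart_nonneg q)]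

lemma integrable_exp_neg_mul_sqNorm {c : ℝ} (hc : 0 < c) :
    Integrable (fun q => Real.exp (-c * sqNorm q)) := by
  have h := integrable_exp_neg_mul_sq hc
  have h2 : Integrable (fun x : ℝ × ℝ => Real.exp (-c * x.1 ^ 2) * Real.exp (-c * x.2 ^ 2)) :=
    h.mul_prod h
  refine (h2.mul_prod h2).congr (Eventually.of_forall fun q => ?_)
  simp only [← Real.exp_add, sqNorm]
  congr 1
  ring

lemma continuous_h5 : Continuous h5 := by
  unfold h5
  fun_prop

lemma measurable_signAbove (η : ℝ) : Measurable (signAbove η) := by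
  unfold signAbove
  refine Measurable.ite (measurableSet_le ?_ measurable_snd) measurable_const measurable_const
  exact (continuous_const.mul (continuous_h5.comp continuous_fst)).measurable

lemma abs_signAbove (η : ℝ) (x) : |signAbove η x| = 1 := by
  unfold signAbove
  split_ifs <;> simp

lemma measurable_signProd (η : ℝ) : Measurable (signProd η) :=
  ((measurable_signAbove η).comp measurable_fst).mul
    ((measurable_signAbove η).comp measurable_snd)

lemma norm_signProd (η : ℝ) (q) : ‖(signProd η q : ℂ)‖ = 1 := by
  rw [Complex.norm_real, Real.norm_eq_abs, signProd, abs_mul, abs_signAbove, abs_signAbove, one_mul]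

lemma continuous_kern (z : ℂ) : Continuous (kern z) := by
  unfold kern
  fun_prop

lemma aestronglyMeasurable_signProd_mul (η : ℝ) {f : (ℝ × ℝ) × (ℝ × ℝ) → ℂ} (hf : Continuous f) :
    AEStronglyMeasurable (fun q => (signProd η q : ℂ) * f q) :=
  ((Complex.measurable_ofReal.comp (measurable_signProd η)).mul hf.measurable).aestronglyMeasurable

lemma strip_re_pos {z : ℂ} (hz : z ∈ strip) : 0 < ((1 + z)⁻¹).re ∧ 0 < ((1 - z)⁻¹).re := by
  have h2 : |z.re| < 1 := hz
  rw [abs_lt] at h2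
  constructor <;> apply inv_re_pos <;> simp <;> linarith

lemma integrable_kern {z : ℂ} (hz : z ∈ strip) : Integrable (kern z) := by
  have h := strip_re_pos hz
  refine (integrable_exp_neg_mul_sqNorm (lt_min h.1 h.2)).mono'
    (continuous_kern z).aestronglyMeasurable (Eventually.of_forall fun q => ?_)
  exact norm_kern_le hz (min_le_left _ _) (min_le_right _ _) q

lemma integrable_signProd_mul_kern (η : ℝ) {z : ℂ} (hz : z ∈ strip) :
    Integrable (fun q => (signProd η q : ℂ) * kern z q) := by
  refine (integrable_kern hz).norm.mono' (aestronglyMeasurable_signProd_mul η (continuous_kern z))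
    (Eventually.of_forall fun q => ?_)
  rw [norm_mul, norm_signProd, one_mul]

lemma hasDerivAt_kern {z : ℂ} (hz : z ∈ strip) (q) :
    HasDerivAt (fun w => kern w q)
      (kern z q * (sumPart q * ((1 + z)⁻¹) ^ 2 - diffPart q * ((1 - z)⁻¹) ^ 2)) z := by
  have h1 := one_add_ne_zero_of_mem_strip hz
  have h2 := one_sub_ne_zero_of_mem_strip hz
  have e : (fun w => kern w q) =ᶠ[𝓝 z] fun w =>
      Complex.exp (-(sumPart q : ℂ) * (1 + w)⁻¹ + -(diffPart q : ℂ) * (1 - w)⁻¹) := by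
    filter_upwards [isOpen_strip.mem_nhds hz] with w hw using kern_eq hw q
  refine HasDerivAt.congr_of_eventuallyEq ?_ e
  rw [kern_eq hz]
  have d1 := (((hasDerivAt_id z).const_add 1).inv h1).const_mul (-(sumPart q : ℂ))
  have d2 := (((hasDerivAt_id z).const_sub 1).inv h2).const_mul (-(diffPart q : ℂ))
  refine ((d1.add d2).cexp).congr_deriv ?_
  simp only [id, Pi.add_apply, Pi.inv_apply]
  congr 1
  field_simp
  ring

lemma differentiableAt_integral_kern (η : ℝ) {z : ℂ} (hz : z ∈ strip) :
    DifferentiableAt ℂ (fun w => ∫ q, (signProd η q : ℂ) * kern w q) z := by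
  have hpos := strip_re_pos hz
  have h1 := one_add_ne_zero_of_mem_strip hz
  have h2 := one_sub_ne_zero_of_mem_strip hz
  -- Half the decay rate at `z`, so that a whole neighbourhood of `z` decays at least at rate `c`.
  set c := min ((1 + z)⁻¹).re ((1 - z)⁻¹).re / 2 with hc
  have hmin : 0 < min ((1 + z)⁻¹).re ((1 - z)⁻¹).re := lt_min hpos.1 hpos.2
  have hc0 : 0 < c := by positivity
  have hc1 : c < ((1 + z)⁻¹).re := by
    have := min_le_left ((1 + z)⁻¹).re ((1 - z)⁻¹).re; linarith
  have hc2 : c < ((1 - z)⁻¹).re := by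
    have := min_le_right ((1 + z)⁻¹).re ((1 - z)⁻¹).re; linarith
  have k1 : ContinuousAt (fun w : ℂ => (1 + w)⁻¹) z :=
    (continuousAt_const.add continuousAt_id).inv₀ h1
  have k2 : ContinuousAt (fun w : ℂ => (1 - w)⁻¹) z :=
    (continuousAt_const.sub continuousAt_id).inv₀ h2
  set C := max ‖(1 + z)⁻¹‖ ‖(1 - z)⁻¹‖ + 1 with hC
  have hC0 : 0 < C := by positivity
  have e1 : ∀ᶠ w in 𝓝 z, c < ((1 + w)⁻¹).re :=
    (Complex.continuous_re.continuousAt.comp k1).eventually (lt_mem_nhds hc1)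
  have e2 : ∀ᶠ w in 𝓝 z, c < ((1 - w)⁻¹).re :=
    (Complex.continuous_re.continuousAt.comp k2).eventually (lt_mem_nhds hc2)
  have e3 : ∀ᶠ w in 𝓝 z, ‖(1 + w)⁻¹‖ < C :=
    k1.norm.eventually (gt_mem_nhds (by have := le_max_left ‖(1 + z)⁻¹‖ ‖(1 - z)⁻¹‖; linarith))
  have e4 : ∀ᶠ w in 𝓝 z, ‖(1 - w)⁻¹‖ < C :=
    k2.norm.eventually (gt_mem_nhds (by have := le_max_right ‖(1 + z)⁻¹‖ ‖(1 - z)⁻¹‖; linarith))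
  have hs := (isOpen_strip.eventually_mem hz).and (e1.and (e2.and (e3.and e4)))
  have key := hasDerivAt_integral_of_dominated_loc_of_deriv_le
    (μ := (volume : Measure ((ℝ × ℝ) × (ℝ × ℝ))))
    (F := fun w q => (signProd η q : ℂ) * kern w q)
    (F' := fun w q => (signProd η q : ℂ) *
      (kern w q * (sumPart q * ((1 + w)⁻¹) ^ 2 - diffPart q * ((1 - w)⁻¹) ^ 2)))
    (bound := fun q => C ^ 2 * (2 / c) * Real.exp (-(c / 2) * sqNorm q)) hs
    (Eventually.of_forall fun w => aestronglyMeasurable_signProd_mul η (continuous_kern w))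
    (integrable_signProd_mul_kern η hz)
    (aestronglyMeasurable_signProd_mul η (by
      unfold sumPart diffPart
      have := continuous_kern z
      fun_prop))
    (Eventually.of_forall fun q w hw => ?_)
    ((integrable_exp_neg_mul_sqNorm (by positivity)).const_mul _)
    (Eventually.of_forall fun q w hw => (hasDerivAt_kern hw.1 q).const_mul _)
  · exact key.2.differentiableAt
  · obtain ⟨hw, hw1, hw2, hw3, hw4⟩ := hw
    rw [norm_mul, norm_signProd, one_mul, norm_mul]
    have b1 := norm_kern_le hw hw1.le hw2.le q
    have b2 : ‖(sumPart q : ℂ) * ((1 + w)⁻¹) ^ 2 - diffPart q * ((1 - w)⁻¹) ^ 2‖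
        ≤ C ^ 2 * sqNorm q := by
      refine (norm_sub_le _ _).trans ?_
      rw [norm_mul, norm_mul, norm_pow, norm_pow, Complex.norm_real, Complex.norm_real,
        Real.norm_of_nonneg (sumPart_nonneg q), Real.norm_of_nonneg (diffPart_nonneg q),
        ← sumPart_add_diffPart, mul_add, mul_comm (C ^ 2), mul_comm (C ^ 2)]
      have := sumPart_nonneg q
      have := diffPart_nonneg q
      gcongr
    -- Half of the remaining decay rate absorbs the quadratic factor produced by differentiating the
    -- kernel.
    have b3 : sqNorm q ≤ 2 / c * Real.exp (c / 2 * sqNorm q) := by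
      have := Real.add_one_le_exp (c / 2 * sqNorm q)
      calc sqNorm q = 2 / c * (c / 2 * sqNorm q) := by field_simp
        _ ≤ _ := by gcongr; linarith
    have b4 : Real.exp (-(c / 2) * sqNorm q) =
        Real.exp (-c * sqNorm q) * Real.exp (c / 2 * sqNorm q) := by
      rw [← Real.exp_add]; congr 1; ring
    calc _ ≤ Real.exp (-c * sqNorm q) * (C ^ 2 * sqNorm q) := by gcongr
      _ ≤ Real.exp (-c * sqNorm q) * (C ^ 2 * (2 / c * Real.exp (c / 2 * sqNorm q))) := by gcongr
      _ = _ := by rw [b4]; ring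

theorem differentiableOn_H (η : ℝ) : DifferentiableOn ℂ (H η) strip := by
  intro z hz
  refine DifferentiableAt.differentiableWithinAt ?_
  have : H η = fun w => 1 / (2 * (Real.pi : ℂ) * (1 - w ^ 2)) *
      ∫ q, (signProd η q : ℂ) * kern w q := rfl
  rw [this]
  refine DifferentiableAt.mul ?_ (differentiableAt_integral_kern η hz)
  refine DifferentiableAt.div (by fun_prop) (by fun_prop) ?_
  have := one_sub_sq_ne_zero_of_mem_strip hz
  exact mul_ne_zero (by simp [Real.pi_ne_zero]) this

/-! ### Symmetries of `H η` -/

lemma H_conj (η : ℝ) (z : ℂ) : H η (starRingEnd ℂ z) = starRingEnd ℂ (H η z) := by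
  rw [H_eq, H_eq, map_mul, ← integral_conj]
  congr 1
  · simp [map_ofNat]
  · congr 1
    ext q
    rw [map_mul, Complex.conj_ofReal, kern, kern, ← Complex.exp_conj]
    simp [map_ofNat]

lemma h5_neg (x : ℝ) : h5 (-x) = -h5 x := by
  unfold h5; ring

lemma signAbove_neg {η : ℝ} {x : ℝ × ℝ} (hx : x.2 ≠ η * h5 x.1) :
    signAbove η (-x) = -signAbove η x := by
  unfold signAbove
  simp only [Prod.fst_neg, Prod.snd_neg, h5_neg]
  rcases lt_or_gt_of_ne hx with h | h
  · rw [if_pos (by linarith), if_neg (by linarith), neg_neg]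
  · rw [if_neg (by linarith), if_pos (by linarith)]

/-- Each vertical section of the graph is one point. The graph is where `signAbove η` fails to be
odd. -/
lemma ae_ne_graph (η : ℝ) : ∀ᵐ x : ℝ × ℝ, x.2 ≠ η * h5 x.1 := by
  have hm : MeasurableSet {x : ℝ × ℝ | x.2 = η * h5 x.1} :=
    (isClosed_eq continuous_snd
      (continuous_const.mul (continuous_h5.comp continuous_fst))).measurableSet
  have : (volume : Measure (ℝ × ℝ)) {x : ℝ × ℝ | x.2 = η * h5 x.1} = 0 := by
    rw [Measure.volume_eq_prod, Measure.measure_prod_null hm]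
    refine Eventually.of_forall fun x => ?_
    simp [preimage]
  rw [ae_iff]
  simpa using this

/-- Substitute `y ↦ -y`: this replaces `z` by `-z` in the kernel and, almost everywhere, flips the
sign of `signAbove η y`. -/
lemma H_neg (η : ℝ) (z : ℂ) : H η (-z) = -H η z := by
  rw [H_eq, H_eq, ← mul_neg, ← integral_neg]
  congr 1
  · simp
  have hmp : MeasurePreserving (fun q : (ℝ × ℝ) × (ℝ × ℝ) => (q.1, -q.2)) volume volume :=
    (MeasurePreserving.id volume).prod (Measure.measurePreserving_neg volume)
  have hemb : MeasurableEmbedding (fun q : (ℝ × ℝ) × (ℝ × ℝ) => (q.1, -q.2)) :=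
    ((MeasurableEquiv.refl (ℝ × ℝ)).prodCongr (MeasurableEquiv.neg (ℝ × ℝ))).measurableEmbedding
  rw [← hmp.integral_comp hemb]
  refine integral_congr_ae ?_
  have hae : ∀ᵐ q : (ℝ × ℝ) × (ℝ × ℝ), q.2.2 ≠ η * h5 q.2.1 :=
    Measure.quasiMeasurePreserving_snd.ae (ae_ne_graph η)
  filter_upwards [hae] with q hq
  have hk : kern (-z) (q.1, -q.2) = kern z q := by
    simp only [kern, Prod.fst_neg, Prod.snd_neg]
    congr 1
    push_cast
    ring
  rw [hk, signProd, signProd, signAbove_neg hq]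
  push_cast
  ring

/-! ### Inverting a small perturbation of the identity -/

/-- On a slightly smaller disc `E` is Lipschitz, so `v + p E(v)` is `1/100`-close to the identity in
the Lipschitz sense and the quantitative inverse function theorem applies. The radii shrink so as to
leave room for Cauchy estimates beyond `9/10`. -/
lemma exists_perturbed_inverse {E : ℂ → ℂ} (hE : DifferentiableOn ℂ E (ball 0 1)) (h0 : E 0 = 0) :
    ∃ M p₁ : ℝ, 0 < M ∧ 0 < p₁ ∧ p₁ ≤ 1 ∧ (∀ v ∈ ball (0 : ℂ) (97 / 100), ‖E v‖ ≤ M) ∧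
      ∀ p ∈ Ioo 0 p₁, ∃ e : OpenPartialHomeomorph ℂ ℂ, (∀ v, e v = v + p * E v) ∧
        e.source = ball 0 (97 / 100) ∧ ball 0 (95 / 100) ⊆ e.target ∧
        DifferentiableOn ℂ e.symm (ball 0 (95 / 100)) := by
  have hsub : closedBall (0 : ℂ) (97 / 100) ⊆ ball 0 1 := closedBall_subset_ball (by norm_num)
  have hsub' : ball (0 : ℂ) (97 / 100) ⊆ ball 0 1 := ball_subset_ball (by norm_num)
  have hd : ContinuousOn (deriv E) (closedBall 0 (97 / 100)) :=
    ((hE.analyticOnNhd isOpen_ball).deriv.continuousOn).mono hsub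
  obtain ⟨C, hC⟩ := (isCompact_closedBall (0 : ℂ) (97 / 100)).exists_bound_of_continuousOn hd
  have hC0 : 0 ≤ C := (norm_nonneg _).trans (hC 0 (by simp; norm_num))
  have hlip : ∀ x ∈ ball (0 : ℂ) (97 / 100), ∀ y ∈ ball (0 : ℂ) (97 / 100),
      ‖E y - E x‖ ≤ C * ‖y - x‖ := fun x hx y hy =>
    (convex_ball (0 : ℂ) (97 / 100)).norm_image_sub_le_of_norm_deriv_le
      (fun z hz => (hE z (hsub' hz)).differentiableAt (isOpen_ball.mem_nhds (hsub' hz)))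
      (fun z hz => hC z (ball_subset_closedBall hz)) hx hy
  refine ⟨C + 1, 1 / (100 * (C + 1)), by positivity, by positivity, ?_, ?_, ?_⟩
  · rw [div_le_one (by positivity)]; linarith
  · intro v hv
    have := hlip 0 (by simp) v hv
    rw [h0, sub_zero, sub_zero] at this
    rw [mem_ball_zero_iff] at hv
    nlinarith [norm_nonneg v]
  rintro p ⟨hp0, hp⟩
  have hpC : p * C ≤ 1 / 100 := by
    rw [lt_div_iff₀ (by positivity)] at hp
    linarith
  have happ : ApproximatesLinearOn (fun v => v + p * E v)
      ((ContinuousLinearEquiv.refl ℂ ℂ : ℂ ≃L[ℂ] ℂ) : ℂ →L[ℂ] ℂ) (ball 0 (97 / 100))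
      (1 / 100) := by
    intro x hx y hy
    have e : x + p * E x - (y + p * E y) -
        ((ContinuousLinearEquiv.refl ℂ ℂ : ℂ ≃L[ℂ] ℂ) : ℂ →L[ℂ] ℂ) (x - y) = p * (E x - E y) := by
      simp; ring
    rw [e, norm_mul, Complex.norm_real, Real.norm_of_nonneg hp0.le]
    have := hlip y hy x hx
    calc _ ≤ p * (C * ‖x - y‖) := by gcongr
      _ = p * C * ‖x - y‖ := by ring
      _ ≤ _ := by
        push_cast
        gcongr
  have hN : ‖((ContinuousLinearEquiv.refl ℂ ℂ).symm : ℂ →L[ℂ] ℂ)‖₊ = 1 := by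
    rw [← NNReal.coe_inj, coe_nnnorm]
    exact ContinuousLinearMap.norm_id
  have hc : Subsingleton ℂ ∨
      (1 / 100 : NNReal) < ‖((ContinuousLinearEquiv.refl ℂ ℂ).symm : ℂ →L[ℂ] ℂ)‖₊⁻¹ := by
    right
    rw [hN, ← NNReal.coe_lt_coe]
    norm_num
  set e := happ.toOpenPartialHomeomorph _ _ hc isOpen_ball with he
  have htar : ball 0 (95 / 100) ⊆ e.target := by
    -- The image of the disc of radius `96/100` contains the disc of radius `(1 - 1/100) · 96/100 =
    -- 0.9504`.
    have := happ.closedBall_subset_target hc isOpen_ball (b := 0) (ε := 96 / 100) (by norm_num)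
      (closedBall_subset_ball (by norm_num))
    refine Subset.trans ?_ this
    rw [hN, h0]
    simp only [mul_zero, add_zero]
    refine ball_subset_closedBall.trans (closedBall_subset_closedBall ?_)
    norm_num
  refine ⟨e, fun v => rfl, rfl, htar, fun w hw => ?_⟩
  have hws : e.symm w ∈ ball (0 : ℂ) (97 / 100) := e.map_target (htar hw)
  have hdE : HasDerivAt E (deriv E (e.symm w)) (e.symm w) :=
    ((hE _ (hsub' hws)).differentiableAt (isOpen_ball.mem_nhds (hsub' hws))).hasDerivAt
  have hde : HasDerivAt e (1 + p * deriv E (e.symm w)) (e.symm w) :=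
    (hasDerivAt_id _).add (hdE.const_mul _)
  refine (e.hasDerivAt_symm (htar hw) ?_ hde).differentiableAt.differentiableWithinAt
  intro h
  have h1 : ‖(p : ℂ) * deriv E (e.symm w)‖ = 1 := by
    rw [eq_neg_of_add_eq_zero_right h]; simp
  rw [norm_mul, Complex.norm_real, Real.norm_of_nonneg hp0.le] at h1
  have := hC _ (ball_subset_closedBall hws)
  nlinarith

/-! ### Taylor coefficients of a perturbation of the sine -/

lemma taylorCoeff_hasSum {G : ℂ → ℂ} {r : ℝ} (hG : DifferentiableOn ℂ G (ball 0 r)) {z : ℂ}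
    (hz : z ∈ ball (0 : ℂ) r) : HasSum (fun k => taylorCoeff G k * z ^ k) (G z) := by
  have e : (fun k : ℕ => (k.factorial : ℂ)⁻¹ • (z - 0) ^ k • iteratedDeriv k G 0) =
      fun k => taylorCoeff G k * z ^ k := by
    funext k
    rw [taylorCoeff, sub_zero, smul_eq_mul, smul_eq_mul]
    ring
  exact e ▸ Complex.hasSum_taylorSeries_on_ball hG hz

lemma norm_taylorCoeff_le {G : ℂ → ℂ} {r R C : ℝ} (hG : DifferentiableOn ℂ G (ball 0 r))
    (hR : 0 < R) (hRr : R < r) (hC : ∀ z ∈ ball (0 : ℂ) r, ‖G z‖ ≤ C) (k : ℕ) :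
    ‖taylorCoeff G k‖ ≤ C / R ^ k := by
  have hsub : closedBall (0 : ℂ) R ⊆ ball 0 r := closedBall_subset_ball hRr
  have := Complex.norm_iteratedDeriv_le_of_forall_mem_sphere_norm_le (C := C) k hR
    ((hG.mono (by rw [closure_ball _ hR.ne']; exact hsub)).diffContOnCl)
    (fun z hz => hC z (hsub (sphere_subset_closedBall hz)))
  have hk : (0 : ℝ) < k.factorial := by exact_mod_cast k.factorial_pos
  rw [taylorCoeff, norm_div, Complex.norm_natCast, div_le_iff₀ hk]
  refine this.trans (le_of_eq ?_)
  ring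

lemma taylorCoeff_sub {f g : ℂ → ℂ} (hf : AnalyticAt ℂ f 0) (hg : AnalyticAt ℂ g 0) (k : ℕ) :
    taylorCoeff (f - g) k = taylorCoeff f k - taylorCoeff g k := by
  rw [taylorCoeff, iteratedDeriv_sub hf.contDiffAt hg.contDiffAt, sub_div]
  rfl

lemma taylorCoeff_even_eq_zero {G : ℂ → ℂ} (hG : ∀ᶠ z in 𝓝 0, G (-z) = -G z) {k : ℕ}
    (hk : Even k) : taylorCoeff G k = 0 := by
  have h1 : iteratedDeriv k (fun z => G (-z)) 0 = iteratedDeriv k (fun z => -G z) 0 :=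
    Filter.EventuallyEq.iteratedDeriv_eq k hG
  rw [iteratedDeriv_comp_neg, hk.neg_one_pow, one_smul, neg_zero, iteratedDeriv_fun_neg] at h1
  rw [taylorCoeff, self_eq_neg.1 h1, zero_div]

lemma taylorCoeff_sin_odd (j : ℕ) :
    taylorCoeff Complex.sin (2 * j + 1) = (-1) ^ j / ((2 * j + 1).factorial : ℂ) := by
  rw [taylorCoeff, Complex.iteratedDeriv_odd_sin]
  simp

/-- Near a positive real the modulus equals the real part up to second order. Both bounds are
needed: in the application `A = 1/k!` and `|w| = O(p)`, the quadratic bound gives `o(p)` for each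
fixed `k`, and the linear one is summable uniformly in `p` after division by `p`. -/
lemma norm_ofReal_add_le {A : ℝ} (hA : 0 < A) (w : ℂ) :
    ‖(A : ℂ) + w‖ ≤ A + w.re + min (2 * ‖w‖) (4 * ‖w‖ ^ 2 / A) := by
  have hre := Complex.abs_re_le_norm w
  rw [abs_le] at hre
  have h1 : ‖(A : ℂ) + w‖ ≤ A + w.re + 2 * ‖w‖ := by
    have := norm_add_le (A : ℂ) w
    rw [Complex.norm_real, Real.norm_of_nonneg hA.le] at this
    linarith
  rw [← min_add_add_left]
  refine le_min h1 ?_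
  -- For `‖w‖ ≤ A/2` one has `A + Re w ≥ A/2`, and squares can be compared; otherwise the linear
  -- bound is already the smaller one.
  rcases le_or_gt ‖w‖ (A / 2) with h | h
  · have hq : 0 ≤ 4 * ‖w‖ ^ 2 / A := by positivity
    refine le_of_sq_le_sq ?_ (by linarith)
    have e : ‖(A : ℂ) + w‖ ^ 2 = A ^ 2 + 2 * A * w.re + ‖w‖ ^ 2 := by
      rw [← Complex.normSq_eq_norm_sq, ← Complex.normSq_eq_norm_sq, Complex.normSq_apply,
        Complex.normSq_apply]
      simp
      ring
    have e2 : ‖w‖ ^ 2 = w.re ^ 2 + w.im ^ 2 := by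
      rw [← Complex.normSq_eq_norm_sq, Complex.normSq_apply]; ring
    have h3 : A / 2 ≤ A + w.re := by linarith
    have h4 : A / 2 * (4 * ‖w‖ ^ 2 / A) ≤ (A + w.re) * (4 * ‖w‖ ^ 2 / A) := by gcongr
    have h5 : A / 2 * (4 * ‖w‖ ^ 2 / A) = 2 * ‖w‖ ^ 2 := by field_simp; ring
    nlinarith [sq_nonneg (4 * ‖w‖ ^ 2 / A), sq_nonneg w.re]
  · refine h1.trans ?_
    gcongr
    rw [le_div_iff₀ hA]
    nlinarith [norm_nonneg w]

/-- Since `(iL)^(2j+1) / i = (-1)^j L^(2j+1)`, evaluation at `iL` undoes the alternating signs of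
the sine series and leaves the positive main term `1/(2j+1)!`. -/
lemma norm_odd_coeff_mul_le {a d : ℂ} {j : ℕ} {L : ℝ} (hL : 0 ≤ L)
    (ha : a = (-1) ^ j / ((2 * j + 1).factorial : ℂ) + d) :
    ‖a‖ * L ^ (2 * j + 1) ≤ (a * (Complex.I * L) ^ (2 * j + 1) / Complex.I).re +
      min (2 * ‖d‖) (4 * ‖d‖ ^ 2 * (2 * j + 1).factorial) * L ^ (2 * j + 1) := by
  set n := 2 * j + 1 with hn
  have hA : (0 : ℝ) < 1 / n.factorial := by positivity
  have hsq : ((-1 : ℂ) ^ j) * (-1) ^ j = 1 := by rw [← mul_pow]; simp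
  have key := norm_ofReal_add_le hA ((-1) ^ j * d)
  have hnd : ‖(-1 : ℂ) ^ j * d‖ = ‖d‖ := by simp
  have haw : (((1 / n.factorial : ℝ)) : ℂ) + (-1) ^ j * d = (-1) ^ j * a := by
    rw [ha, mul_add, mul_div_assoc', hsq]
    push_cast
    rfl
  have hna : ‖(-1 : ℂ) ^ j * a‖ = ‖a‖ := by simp
  rw [haw, hna, hnd, div_div_eq_mul_div, div_one] at key
  have hre : 1 / (n.factorial : ℝ) + ((-1) ^ j * d).re = ((-1) ^ j * a).re := by
    rw [← haw, Complex.add_re, Complex.ofReal_re]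
  rw [hre] at key
  have hI : a * (Complex.I * L) ^ n / Complex.I = ((L ^ n : ℝ) : ℂ) * ((-1) ^ j * a) := by
    rw [hn, mul_pow, pow_succ Complex.I, pow_mul, Complex.I_sq]
    field_simp
    push_cast
    ring
  rw [hI, Complex.re_ofReal_mul]
  have hLn : 0 ≤ L ^ n := by positivity
  calc _ ≤ (((-1) ^ j * a).re + min (2 * ‖d‖) (4 * ‖d‖ ^ 2 * n.factorial)) * L ^ n := by gcongr
    _ = _ := by ring

lemma sinh_eq_norm_sin (x : ℝ) : Real.sinh x ≤ ‖Complex.sin (x * Complex.I)‖ := by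
  rw [Complex.sin_mul_I, norm_mul, Complex.norm_I, mul_one, ← Complex.ofReal_sinh,
    Complex.norm_real]
  exact Real.le_norm_self _

/-- If `G` is an odd function within `p M` of the sine function, with `Im G (iL) ≤ 1 - p c`, where
`sinh L = 1`, then `∑ |aₖ| xᵏ` takes the value `1` to the right of `L`, for small `p`. -/
theorem exists_taylor_norm_root {L M c : ℝ} (hL0 : 0 < L) (hL : L < 89 / 100)
    (hsinh : 1 < Real.sinh (89 / 100)) (hM : 0 < M) (hc : 0 < c) :
    ∃ p₂ : ℝ, 0 < p₂ ∧ ∀ p ∈ Ioo 0 p₂, ∀ G : ℂ → ℂ, DifferentiableOn ℂ G (ball 0 (95 / 100)) →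
      (∀ z ∈ ball (0 : ℂ) (95 / 100), G (-z) = -G z) →
      (∀ z ∈ ball (0 : ℂ) (95 / 100), ‖G z - Complex.sin z‖ ≤ p * M) →
      (G (Complex.I * L) / Complex.I).re ≤ 1 - p * c →
      ∃ γ : ℝ, 0 ≤ γ ∧ HasSum (fun k : ℕ => ‖taylorCoeff G (k + 1)‖ * γ ^ (k + 1)) 1 ∧ L < γ := by
  -- The cost of replacing `|aₖ| Lᵏ` by the real part of the `k`-th term of `G(iL)/i`, divided by
  -- `p`. Cauchy's estimate at radius `94/100 > L` makes it geometrically summable uniformly in `p`,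
  -- and each term tends to `0` with `p`.
  set τ : ℝ → ℕ → ℝ := fun p k =>
    min (2 * (M / (94 / 100) ^ k)) (4 * (M / (94 / 100) ^ k) ^ 2 * k.factorial * p) * L ^ k with hτ
  have hbnd : Summable fun k : ℕ => 2 * M * (L / (94 / 100)) ^ k :=
    (summable_geometric_of_lt_one (by positivity)
      (by rw [div_lt_one (by norm_num)]; linarith)).mul_left _
  have hτ0 : ∀ p, 0 ≤ p → ∀ k, 0 ≤ τ p k := fun p hp k => by positivity
  have hτb : ∀ p, 0 ≤ p → ∀ k, τ p k ≤ 2 * M * (L / (94 / 100)) ^ k := fun p hp k => by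
    calc τ p k ≤ 2 * (M / (94 / 100) ^ k) * L ^ k := by
          simp only [hτ]; gcongr; exact min_le_left _ _
      _ = _ := by rw [div_pow L (94 / 100), ← mul_div_assoc, ← mul_div_assoc, div_mul_eq_mul_div]
  have hτs : ∀ p, 0 ≤ p → Summable (τ p) := fun p hp =>
    Summable.of_nonneg_of_le (hτ0 p hp) (hτb p hp) hbnd
  have htend : Tendsto (fun p => ∑' k, τ p k) (𝓝[>] 0) (𝓝 (∑' _ : ℕ, (0 : ℝ))) := by
    refine tendsto_tsum_of_dominated_convergence hbnd (fun k => ?_) ?_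
    · have : Continuous fun p => τ p k := by simp only [hτ]; fun_prop
      have h := this.tendsto 0
      have h00 : τ 0 k = 0 := by
        simp only [hτ, mul_zero]
        rw [min_eq_right (by positivity), zero_mul]
      rw [h00] at h
      exact h.mono_left nhdsWithin_le_nhds
    · filter_upwards [self_mem_nhdsWithin] with p hp k
      rw [Real.norm_of_nonneg (hτ0 p (le_of_lt hp) k)]
      exact hτb p (le_of_lt hp) k
  rw [tsum_zero] at htend
  have hev : ∀ᶠ p in 𝓝[>] (0 : ℝ), ∑' k, τ p k < c := htend.eventually (gt_mem_nhds hc)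
  have hev2 : ∀ᶠ p in 𝓝[>] (0 : ℝ), p < (Real.sinh (89 / 100) - 1) / M :=
    (eventually_lt_nhds (div_pos (by linarith) hM)).filter_mono nhdsWithin_le_nhds
  obtain ⟨p₂, hp₂, hsub⟩ := mem_nhdsGT_iff_exists_Ioo_subset.1 (hev.and hev2)
  refine ⟨p₂, hp₂, fun p hp G hG hodd hclose hre => ?_⟩
  obtain ⟨hp1, hp2⟩ := hsub hp
  have hp0 : 0 < p := hp.1
  set a := taylorCoeff G with ha
  have hGa : AnalyticAt ℂ G 0 := hG.analyticAt (ball_mem_nhds _ (by norm_num))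
  have hsa : AnalyticAt ℂ Complex.sin 0 := Complex.differentiable_sin.analyticAt 0
  have hd : ∀ k, ‖taylorCoeff (G - Complex.sin) k‖ ≤ p * M / (94 / 100) ^ k :=
    norm_taylorCoeff_le (r := 95 / 100) (hG.sub Complex.differentiable_sin.differentiableOn)
      (by norm_num) (by norm_num) hclose
  have heven : ∀ k, Even k → a k = 0 := fun k hk => taylorCoeff_even_eq_zero (by
    filter_upwards [ball_mem_nhds (0 : ℂ) (show (0 : ℝ) < 95 / 100 by norm_num)] with z hz
    exact hodd z hz) hk
  have hIL : Complex.I * L ∈ ball (0 : ℂ) (95 / 100) := by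
    rw [mem_ball_zero_iff, norm_mul, Complex.norm_I, one_mul, Complex.norm_real,
      Real.norm_of_nonneg hL0.le]
    linarith
  have hterm : ∀ k, ‖a k‖ * L ^ k ≤ (a k * (Complex.I * L) ^ k / Complex.I).re + p * τ p k := by
    intro k
    rcases Nat.even_or_odd' k with ⟨j, rfl | rfl⟩
    · rw [heven _ (even_two_mul j)]
      have := hτ0 p hp0.le (2 * j)
      simp only [norm_zero, zero_mul, zero_div, Complex.zero_re, zero_add]
      positivity
    · have h1 : a (2 * j + 1) = (-1) ^ j / ((2 * j + 1).factorial : ℂ) +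
          taylorCoeff (G - Complex.sin) (2 * j + 1) := by
        rw [taylorCoeff_sub hGa hsa, ← taylorCoeff_sin_odd]; ring
      refine (norm_odd_coeff_mul_le hL0.le h1).trans ?_
      have hdk := hd (2 * j + 1)
      set n := 2 * j + 1
      have h2 : p * τ p n = min (2 * (p * M / (94 / 100) ^ n))
          (4 * (p * M / (94 / 100) ^ n) ^ 2 * n.factorial) * L ^ n := by
        simp only [hτ]
        rw [← mul_assoc, mul_min_of_nonneg _ _ hp0.le]
        congr 2 <;> ring
      rw [h2]
      gcongr
  have hsum : ∀ z ∈ ball (0 : ℂ) (95 / 100), HasSum (fun k => a k * z ^ k) (G z) := fun z hz =>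
    taylorCoeff_hasSum hG hz
  have h89 : ((89 / 100 : ℝ) : ℂ) * Complex.I ∈ ball (0 : ℂ) (95 / 100) := by
    rw [mem_ball_zero_iff, norm_mul, Complex.norm_I, mul_one, Complex.norm_real]
    norm_num
  have hnorm89 : Summable fun k => ‖a k‖ * (89 / 100) ^ k := by
    refine (hsum _ h89).summable.norm.congr fun k => ?_
    rw [norm_mul, norm_pow, norm_mul, Complex.norm_I, mul_one, Complex.norm_real]
    norm_num
  set S : ℝ → ℝ := fun x => ∑' k, ‖a k‖ * x ^ k with hS
  have hcont : ContinuousOn S (Icc L (89 / 100)) := by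
    refine continuousOn_tsum (fun k => by fun_prop) hnorm89 fun k x hx => ?_
    have hx0 : 0 ≤ x := hL0.le.trans hx.1
    rw [Real.norm_of_nonneg (by positivity)]
    gcongr
    exact hx.2
  have hsL : Summable fun k => ‖a k‖ * L ^ k :=
    Summable.of_nonneg_of_le (fun k => by positivity) (fun k => by gcongr) hnorm89
  -- The sum is at most `(1 - p c) + p ∑ τ`, and `∑ τ < c` by the choice of `p₂`.
  have hSL : S L < 1 := by
    have hs1 : HasSum (fun k => (a k * (Complex.I * L) ^ k / Complex.I).re)
        (G (Complex.I * L) / Complex.I).re := by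
      have := (hsum _ hIL).div_const Complex.I
      exact Complex.hasSum_re this
    have hs2 := ((hτs p hp0.le).mul_left p)
    have := hsL.tsum_le_tsum hterm (hs1.summable.add hs2)
    rw [hs1.summable.tsum_add hs2, hs1.tsum_eq, tsum_mul_left] at this
    have h3 : p * ∑' k, τ p k < p * c := by gcongr
    simp only [hS]
    linarith
  -- The sum of absolute values dominates `|G(0.89 i)| ≥ sinh 0.89 - p M`, which exceeds `1` by the
  -- choice of `p₂`.
  have hS89 : 1 ≤ S (89 / 100) := by
    have h1 : ‖G ((89 / 100 : ℝ) * Complex.I)‖ ≤ S (89 / 100) := by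
      rw [← (hsum _ h89).tsum_eq]
      refine (norm_tsum_le_tsum_norm (hsum _ h89).summable.norm).trans (le_of_eq ?_)
      refine tsum_congr fun k => ?_
      rw [norm_mul, norm_pow, norm_mul, Complex.norm_I, mul_one, Complex.norm_real]
      norm_num
    have h2 := hclose _ h89
    have h3 := sinh_eq_norm_sin (89 / 100)
    have h4 : p * M < Real.sinh (89 / 100) - 1 := (lt_div_iff₀ hM).1 hp2
    have h5 := norm_sub_norm_le (Complex.sin ((89 / 100 : ℝ) * Complex.I))
      (G ((89 / 100 : ℝ) * Complex.I))
    rw [norm_sub_rev] at h5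
    linarith
  obtain ⟨γ, hγ, hγ1⟩ := intermediate_value_Icc hL.le hcont ⟨hSL.le, hS89⟩
  refine ⟨γ, hL0.le.trans hγ.1, ?_, ?_⟩
  · have hsγ : Summable fun k => ‖a k‖ * γ ^ k := by
      have hγ0 : 0 ≤ γ := hL0.le.trans hγ.1
      refine Summable.of_nonneg_of_le (fun k => by positivity) (fun k => ?_) hnorm89
      gcongr
      exact hγ.2
    have h1 : HasSum (fun k => ‖a k‖ * γ ^ k) 1 := by
      rw [← hγ1]; exact hsγ.hasSum
    have h2 := (hasSum_nat_add_iff' 1).2 h1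
    simpa [heven 0 (by simp)] using h2
  · refine lt_of_le_of_ne hγ.1 ?_
    rintro rfl
    exact absurd hγ1 hSL.ne

/-- First order effect of the perturbation at the point `iL`. -/
lemma re_sin_perturbed_le {E : ℂ → ℂ} {L M δ : ℝ} (hM : 0 < M) (hδ : 0 < δ)
    (hL : Real.sinh L = 1) (hE : ContinuousAt E (Complex.I * L))
    (hpos : (E (Complex.I * L) / Complex.I).re = δ) :
    ∃ r : ℝ, 0 < r ∧ ∀ p : ℝ, 0 < p → ∀ V : ℂ, dist V (Complex.I * L) < r →
      V = Complex.I * L - p * E V → ‖E V‖ ≤ M →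
      (Complex.sin V / Complex.I).re ≤ 1 - p * (δ / 4) := by
  have h1 : ∀ᶠ V in 𝓝 (Complex.I * L), δ / 2 < (E V / Complex.I).re := by
    have : ContinuousAt (fun V => (E V / Complex.I).re) (Complex.I * L) :=
      Complex.continuous_re.continuousAt.comp (hE.div_const _)
    exact this.eventually (lt_mem_nhds (by simp only [hpos]; linarith))
  -- Error budget: the linear term lowers `sin V / i` by at least `p δ / 2` because `cosh L ≥ 1`; a
  -- linearisation error of at most `δ/(4M) · p M` leaves a gain of `p δ / 4`.
  have h2 := (Complex.hasDerivAt_sin (Complex.I * L)).isLittleO.def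
    (show (0 : ℝ) < δ / (4 * M) by positivity)
  obtain ⟨r, hr, hball⟩ := Metric.eventually_nhds_iff.1 (h1.and h2)
  refine ⟨r, hr, fun p hp V hV hVe hEV => ?_⟩
  obtain ⟨h3, h4⟩ := hball hV
  have hsin : Complex.sin (Complex.I * L) = Complex.I := by
    rw [mul_comm, Complex.sin_mul_I, ← Complex.ofReal_sinh, hL]; simp
  have hcos : Complex.cos (Complex.I * L) = (Real.cosh L : ℂ) := by
    rw [mul_comm, Complex.cos_mul_I, Complex.ofReal_cosh]
  have hVsub : V - Complex.I * L = -(p * E V) := by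
    nth_rewrite 1 [hVe]; ring
  rw [hVsub, hsin, hcos, norm_neg, norm_mul, Complex.norm_real, Real.norm_of_nonneg hp.le,
    smul_eq_mul] at h4
  set ρ := Complex.sin V - Complex.I - -(p * E V) * (Real.cosh L : ℂ) with hρ
  have hs : Complex.sin V / Complex.I = 1 - ((p * Real.cosh L : ℝ) : ℂ) * (E V / Complex.I)
      + ρ / Complex.I := by
    rw [hρ]; field_simp; push_cast; ring
  have hρn : (ρ / Complex.I).re ≤ p * (δ / 4) := by
    refine (Complex.re_le_norm _).trans ?_
    rw [norm_div, Complex.norm_I, div_one]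
    refine h4.trans ?_
    calc δ / (4 * M) * (p * ‖E V‖) ≤ δ / (4 * M) * (p * M) := by gcongr
      _ = _ := by field_simp
  rw [hs, Complex.add_re, Complex.sub_re, Complex.one_re, Complex.re_ofReal_mul]
  have h5 := Real.one_le_cosh L
  have h6 : p * (δ / 2) ≤ p * Real.cosh L * (E V / Complex.I).re := by
    have : 1 * (δ / 2) ≤ Real.cosh L * (E V / Complex.I).re := by gcongr
    nlinarith
  linarith

/-! ### The sine maps the unit disc into the strip -/

/-- For `v = a + ib` the square of `Re sin v = sin a cosh b` is at most `a² exp (b²)`. As `|v| ≤ 1`,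
also `a² = |v|² - b² ≤ |v|² (1 - b²) ≤ |v|² exp (-b²)`. -/
lemma abs_re_sin_le {v : ℂ} (hv : ‖v‖ ≤ 1) : |(Complex.sin v).re| ≤ ‖v‖ := by
  have hre : (Complex.sin v).re = Real.sin v.re * Real.cosh v.im := by
    rw [Complex.sin_eq, Complex.add_re, Complex.mul_I_re, ← Complex.ofReal_sin,
      ← Complex.ofReal_cosh, ← Complex.ofReal_cos, ← Complex.ofReal_sinh, ← Complex.ofReal_mul,
      ← Complex.ofReal_mul, Complex.ofReal_re, Complex.ofReal_im, neg_zero, add_zero]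
  have h1 : (Real.sin v.re) ^ 2 ≤ v.re ^ 2 := by
    rw [sq_le_sq]; exact Real.abs_sin_le_abs
  have h2 : Real.cosh v.im ≤ Real.exp (v.im ^ 2 / 2) := Real.cosh_le_exp_half_sq _
  have h3 : (Real.cosh v.im) ^ 2 ≤ Real.exp (v.im ^ 2) := by
    calc (Real.cosh v.im) ^ 2 ≤ (Real.exp (v.im ^ 2 / 2)) ^ 2 := by
          gcongr
      _ = _ := by rw [← Real.exp_nat_mul]; congr 1; push_cast; ring
  have h4 : 1 - v.im ^ 2 ≤ Real.exp (-v.im ^ 2) := by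
    have := Real.add_one_le_exp (-v.im ^ 2); linarith
  have e2 : ‖v‖ ^ 2 = v.re ^ 2 + v.im ^ 2 := by
    rw [← Complex.normSq_eq_norm_sq, Complex.normSq_apply]; ring
  have h5 : v.re ^ 2 ≤ ‖v‖ ^ 2 * Real.exp (-v.im ^ 2) := by
    have : ‖v‖ ^ 2 * (1 - v.im ^ 2) ≤ ‖v‖ ^ 2 * Real.exp (-v.im ^ 2) := by gcongr
    have h6 : ‖v‖ ^ 2 ≤ 1 := by nlinarith [norm_nonneg v]
    nlinarith [sq_nonneg v.im]
  refine abs_le_of_sq_le_sq ?_ (norm_nonneg v)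
  rw [hre, mul_pow]
  calc _ ≤ v.re ^ 2 * Real.exp (v.im ^ 2) := by gcongr
    _ ≤ ‖v‖ ^ 2 * Real.exp (-v.im ^ 2) * Real.exp (v.im ^ 2) := by gcongr
    _ = ‖v‖ ^ 2 := by rw [mul_assoc, ← Real.exp_add]; simp

lemma sin_mem_strip {v : ℂ} (hv : v ∈ ball (0 : ℂ) 1) : Complex.sin v ∈ strip := by
  rw [mem_ball_zero_iff] at hv
  exact (abs_re_sin_le hv.le).trans_lt hv

lemma differentiableOn_H_sin (η : ℝ) :
    DifferentiableOn ℂ (fun v => H η (Complex.sin v)) (ball 0 1) :=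
  (differentiableOn_H η).comp Complex.differentiable_sin.differentiableOn fun _ hv =>
    sin_mem_strip hv

/-! ### Rearranging the four-fold integral -/

/-- Passes from `((x₁, y₁), (x₂, y₂))` to `((x₁, x₂), (y₁, y₂))`. In the first grouping the Gaussian
kernel is a product of two planar kernels. -/
def pairUp (r : (ℝ × ℝ) × (ℝ × ℝ)) : (ℝ × ℝ) × (ℝ × ℝ) := ((r.1.1, r.2.1), (r.1.2, r.2.2))

lemma measurePreserving_pairUp : MeasurePreserving pairUp volume volume := by
  have a1 : MeasurePreserving (MeasurableEquiv.prodAssoc : (ℝ × ℝ) × (ℝ × ℝ) ≃ᵐ ℝ × (ℝ × (ℝ × ℝ)))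
    volume volume := volume_preserving_prodAssoc
  have a2 : MeasurePreserving (MeasurableEquiv.prodAssoc : (ℝ × ℝ) × ℝ ≃ᵐ ℝ × (ℝ × ℝ))
    volume volume := volume_preserving_prodAssoc
  have sw : MeasurePreserving (Prod.swap : ℝ × ℝ → ℝ × ℝ) volume volume :=
    Measure.measurePreserving_swap
  have m : MeasurePreserving (fun x : ℝ × (ℝ × ℝ) =>
      MeasurableEquiv.prodAssoc ((Prod.map Prod.swap id) (MeasurableEquiv.prodAssoc.symm x)))
      volume volume :=
    a2.comp ((sw.prod (MeasurePreserving.id volume)).comp (a2.symm _))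
  exact (a1.symm _).comp (((MeasurePreserving.id volume).prod m).comp a1)

lemma pairUp_pairUp (r) : pairUp (pairUp r) = r := rfl

def pairUpEquiv : (ℝ × ℝ) × (ℝ × ℝ) ≃ᵐ (ℝ × ℝ) × (ℝ × ℝ) where
  toFun := pairUp
  invFun := pairUp
  left_inv := pairUp_pairUp
  right_inv := pairUp_pairUp
  measurable_toFun := measurePreserving_pairUp.measurable
  measurable_invFun := measurePreserving_pairUp.measurable

lemma integral_pairUp {V : Type*} [NormedAddCommGroup V] [NormedSpace ℝ V]
    (f : (ℝ × ℝ) × (ℝ × ℝ) → V) : ∫ r, f (pairUp r) = ∫ q, f q :=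
  measurePreserving_pairUp.integral_comp pairUpEquiv.measurableEmbedding f

lemma integrable_pairUp {V : Type*} [NormedAddCommGroup V]
    {f : (ℝ × ℝ) × (ℝ × ℝ) → V} (hf : Integrable f) : Integrable fun r => f (pairUp r) :=
  (measurePreserving_pairUp.integrable_comp_emb pairUpEquiv.measurableEmbedding).2 hf

/-! ### The Gaussian sign correlation (Grothendieck's identity) -/

/-- The sign function with value `1` at the origin. -/
def sgn (x : ℝ) : ℝ := if 0 ≤ x then 1 else -1

lemma abs_sgn (x : ℝ) : |sgn x| = 1 := by unfold sgn; split_ifs <;> simp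

lemma measurable_sgn : Measurable sgn :=
  Measurable.ite measurableSet_Ici measurable_const measurable_const

lemma sgn_mul_pos {c x : ℝ} (hc : 0 < c) : sgn (c * x) = sgn x := by
  unfold sgn
  simp only [mul_nonneg_iff_of_pos_left hc]

lemma sgn_mul_self (x : ℝ) : sgn x * x = |x| := by
  unfold sgn
  split_ifs with h
  · rw [one_mul, abs_of_nonneg h]
  · rw [abs_of_neg (not_le.1 h)]; ring

/-- For an even integrable function, shifting the sign change amounts to integrating up to the
shift. -/
lemma integral_sgn_add_mul {V : Type*} [NormedAddCommGroup V] [NormedSpace ℝ V]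
    {f : ℝ → V} (hf : Integrable f) (a : ℝ) :
    ∫ u, sgn (u + a) • f u = (∫ u, sgn u • f u) + (2 : ℝ) • ∫ u in (-a)..0, f u := by
  have hI : ∀ b : ℝ, ∫ u, sgn (u + b) • f u = (∫ u, f u) - (2 : ℝ) • ∫ u in Iio (-b), f u := by
    intro b
    have : ∀ u, sgn (u + b) • f u = f u - (Iio (-b)).indicator (fun u => (2 : ℝ) • f u) u := by
      intro u
      unfold sgn indicator
      by_cases h : 0 ≤ u + b
      · rw [if_pos h, if_neg (by simp; linarith)]; simp
      · rw [if_neg h, if_pos (by simp; linarith), neg_one_smul]; simp only [two_smul]; abel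
    simp_rw [this]
    have hf2 : Integrable fun u => (Iio (-b)).indicator (fun u => (2 : ℝ) • f u) u :=
      (hf.smul (2 : ℝ)).indicator measurableSet_Iio
    rw [integral_sub hf hf2,
      integral_indicator measurableSet_Iio, integral_smul]
  have h0 := hI 0
  simp only [add_zero, neg_zero] at h0
  rw [hI a, h0, ← integral_Iic_eq_integral_Iio, ← integral_Iic_eq_integral_Iio,
    ← intervalIntegral.integral_Iic_sub_Iic hf.integrableOn hf.integrableOn, smul_sub]
  abel

lemma integral_sgn_mul_even {f : ℝ → ℝ} (he : ∀ x, f (-x) = f x) :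
    ∫ u, sgn u • f u = 0 := by
  have h : ∫ u, sgn u • f u = ∫ u, -(sgn u • f u) := by
    rw [← integral_neg_eq_self (fun u => sgn u • f u)]
    refine integral_congr_ae ?_
    have : ∀ᵐ x : ℝ, x ≠ 0 := Measure.ae_ne volume 0
    filter_upwards [this] with x hx
    rw [he]
    unfold sgn
    rcases lt_or_gt_of_ne hx with h | h
    · rw [if_pos (by linarith), if_neg (by linarith)]; simp
    · rw [if_neg (by linarith), if_pos (by linarith)]; simp
  rw [integral_neg] at h
  linarith

lemma integrable_exp_neg_sq : Integrable fun u : ℝ => Real.exp (-u ^ 2) := by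
  simpa using integrable_exp_neg_mul_sq (b := 1) one_pos

lemma integral_sgn_add_exp (a : ℝ) :
    ∫ u, sgn (u + a) * Real.exp (-u ^ 2) = 2 * ∫ u in (0 : ℝ)..a, Real.exp (-u ^ 2) := by
  have h := integral_sgn_add_mul integrable_exp_neg_sq a
  rw [integral_sgn_mul_even (fun x => by simp)] at h
  simp only [smul_eq_mul, zero_add] at h
  rw [h]
  congr 1
  have := intervalIntegral.integral_comp_neg (a := 0) (b := a) fun u : ℝ => Real.exp (-u ^ 2)
  simp only [neg_zero, even_two, Even.neg_pow] at this
  exact this.symm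

lemma integral_abs_mul_exp {b : ℝ} (hb : 0 < b) :
    ∫ y : ℝ, |y| * Real.exp (-b * y ^ 2) = 1 / b := by
  have h1 : ∫ y : ℝ, |y| * Real.exp (-b * y ^ 2) =
      2 * ∫ y in Ioi (0 : ℝ), y * Real.exp (-b * y ^ 2) := by
    have := integral_comp_abs (f := fun y : ℝ => y * Real.exp (-b * y ^ 2))
    simpa [sq_abs] using this
  have h2 := integral_rpow_mul_exp_neg_mul_rpow (p := 2) (q := 1) (b := b) (by norm_num)
    (by norm_num) hb
  rw [h1]
  have h3 : ∫ y in Ioi (0 : ℝ), y * Real.exp (-b * y ^ 2) = 1 / (2 * b) := by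
    have e : ∫ y in Ioi (0 : ℝ), y * Real.exp (-b * y ^ 2) =
      ∫ y in Ioi (0 : ℝ), y ^ (1 : ℝ) * Real.exp (-b * y ^ (2 : ℝ)) := by simp
    rw [e, h2]
    norm_num [Real.rpow_neg_one]
  rw [h3]
  field_simp

lemma integrable_abs_mul_exp {b : ℝ} (hb : 0 < b) :
    Integrable fun y : ℝ => |y| * Real.exp (-b * y ^ 2) := by
  have := (integrable_mul_exp_neg_mul_sq hb).norm
  simpa [abs_mul] using this

/-- Write the inner integral as `y ∫₀ᵐ exp (-(μ y)²) dμ` and exchange the integrals. The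
`y`-integral becomes `1/(1 + μ²)`, the derivative of the arctangent. -/
lemma integral_sgn_mul_exp_mul_erf {m : ℝ} (hm : 0 ≤ m) :
    ∫ y, sgn y * Real.exp (-y ^ 2) * (2 * ∫ u in (0 : ℝ)..(m * y), Real.exp (-u ^ 2)) =
      2 * Real.arctan m := by
  have h1 : ∀ y, sgn y * Real.exp (-y ^ 2) * (2 * ∫ u in (0 : ℝ)..(m * y), Real.exp (-u ^ 2)) =
      ∫ μ in (0 : ℝ)..m, 2 * (|y| * Real.exp (-(1 + μ ^ 2) * y ^ 2)) := by
    intro y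
    have h2 : ∫ u in (0 : ℝ)..(m * y), Real.exp (-u ^ 2) =
        y * ∫ μ in (0 : ℝ)..m, Real.exp (-(μ * y) ^ 2) := by
      have := intervalIntegral.smul_integral_comp_mul_right (a := 0) (b := m)
        (fun u : ℝ => Real.exp (-u ^ 2)) y
      rw [zero_mul] at this
      exact this.symm
    rw [h2]
    have h3 : sgn y * Real.exp (-y ^ 2) * (2 * (y * ∫ μ in (0 : ℝ)..m, Real.exp (-(μ * y) ^ 2))) =
        (2 * (sgn y * y) * Real.exp (-y ^ 2)) * ∫ μ in (0 : ℝ)..m, Real.exp (-(μ * y) ^ 2) := by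
      ring
    rw [h3, sgn_mul_self, ← intervalIntegral.integral_const_mul]
    congr 1
    ext μ
    rw [mul_assoc, ← Real.exp_add, mul_assoc]
    congr 3
    ring
  simp_rw [h1, intervalIntegral.integral_of_le hm]
  rw [integral_integral_swap]
  · have h4 : ∀ μ : ℝ, ∫ y : ℝ, 2 * (|y| * Real.exp (-(1 + μ ^ 2) * y ^ 2)) =
        2 * (1 / (1 + μ ^ 2)) := by
      intro μ
      rw [integral_const_mul, integral_abs_mul_exp (by positivity)]
    simp_rw [h4]
    rw [← intervalIntegral.integral_of_le hm, intervalIntegral.integral_const_mul,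
      integral_one_div_one_add_sq, Real.arctan_zero, sub_zero]
  · have hb : Integrable (fun q : ℝ × ℝ => (|q.1| * Real.exp (-1 * q.1 ^ 2)) * 2)
        (volume.prod (volume.restrict (Ioc 0 m))) :=
      (integrable_abs_mul_exp one_pos).mul_prod (integrable_const (2 : ℝ))
    refine hb.mono' ?_ (Eventually.of_forall fun q => ?_)
    · refine Continuous.aestronglyMeasurable ?_
      simp only [Function.uncurry_def]
      fun_prop
    · simp only [Function.uncurry]
      rw [Real.norm_of_nonneg (by positivity), mul_comm]
      gcongr
      nlinarith [sq_nonneg q.2, sq_nonneg q.1, mul_nonneg (sq_nonneg q.2) (sq_nonneg q.1)]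

/-- A centred Gaussian weight on the plane with correlation `sin s`. -/
def corrWeight (s : ℝ) (x : ℝ × ℝ) : ℝ :=
  Real.exp (-(x.1 ^ 2 + x.2 ^ 2 - 2 * Real.sin s * (x.1 * x.2)) / Real.cos s ^ 2)

/-- Completing the square: the shear `x = cos s · u + sin s · y` decorrelates the two Gaussian
variables. -/
lemma corrWeight_eq {s : ℝ} (hs : Real.cos s ≠ 0) (u y : ℝ) :
    corrWeight s (Real.cos s * u + Real.sin s * y, y) =
      Real.exp (-y ^ 2) * Real.exp (-u ^ 2) := by
  rw [corrWeight, ← Real.exp_add]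
  congr 1
  rw [div_eq_iff (pow_ne_zero 2 hs)]
  have := Real.sin_sq_add_cos_sq s
  have h2 : Real.sin s ^ 2 = 1 - Real.cos s ^ 2 := by linarith
  simp only
  ring_nf
  rw [h2]
  ring

lemma integrable_corrWeight {s : ℝ} (hs : 0 < Real.cos s) : Integrable (corrWeight s) := by
  have hg : Integrable fun x : ℝ × ℝ =>
      Real.exp (-(1 / 2) * x.1 ^ 2) * Real.exp (-(1 / 2) * x.2 ^ 2) :=
    (integrable_exp_neg_mul_sq (by norm_num)).mul_prod (integrable_exp_neg_mul_sq (by norm_num))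
  refine hg.mono' (Continuous.aestronglyMeasurable (by unfold corrWeight; fun_prop))
    (Eventually.of_forall fun x => ?_)
  rw [corrWeight, Real.norm_of_nonneg (Real.exp_nonneg _), ← Real.exp_add, Real.exp_le_exp,
    div_le_iff₀ (by positivity)]
  have h1 := Real.sin_sq_add_cos_sq s
  have h2 : Real.cos s ^ 2 = 1 - Real.sin s ^ 2 := by linarith
  rw [h2]
  nlinarith [sq_nonneg (x.1 - Real.sin s * x.2), sq_nonneg (x.2 - Real.sin s * x.1)]

lemma integral_corrWeight {s : ℝ} (hs : 0 < Real.cos s) {w : ℝ → ℝ → ℝ}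
    (hw : Measurable (Function.uncurry w)) (hb : ∀ x y, |w x y| ≤ 1) :
    ∫ x : ℝ × ℝ, w x.1 x.2 * corrWeight s x =
      Real.cos s * ∫ y, Real.exp (-y ^ 2) *
        ∫ u, w (Real.cos s * u + Real.sin s * y) y * Real.exp (-u ^ 2) := by
  have hint : Integrable fun x : ℝ × ℝ => w x.1 x.2 * corrWeight s x := by
    refine (integrable_corrWeight hs).norm.mono'
      (hw.aestronglyMeasurable.mul (integrable_corrWeight hs).aestronglyMeasurable)
      (Eventually.of_forall fun x => ?_)
    rw [norm_mul]
    exact mul_le_of_le_one_left (norm_nonneg _) (hb _ _)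
  rw [Measure.volume_eq_prod, integral_prod_symm _ hint, ← integral_const_mul]
  congr 1
  ext y
  have h1 : ∫ x, w x y * corrWeight s (x, y) = ∫ x, w (x + Real.sin s * y) y *
      corrWeight s (x + Real.sin s * y, y) :=
    (integral_add_right_eq_self (fun x => w x y * corrWeight s (x, y)) (Real.sin s * y)).symm
  have h2 := Measure.integral_comp_mul_left (fun x => w (x + Real.sin s * y) y *
      corrWeight s (x + Real.sin s * y, y)) (Real.cos s)
  rw [abs_of_pos (inv_pos.2 hs), smul_eq_mul, eq_inv_mul_iff_mul_eq₀ hs.ne'] at h2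
  simp only
  rw [h1, ← h2]
  congr 1
  rw [← integral_const_mul]
  congr 1
  ext u
  rw [corrWeight_eq hs.ne']
  ring

lemma integral_corrWeight_one {s : ℝ} (hs : 0 < Real.cos s) :
    ∫ x : ℝ × ℝ, corrWeight s x = Real.cos s * Real.pi := by
  have h := integral_corrWeight hs (w := fun _ _ => 1) (by simp [Function.uncurry_def]) (by simp)
  have hg : ∫ u : ℝ, Real.exp (-u ^ 2) = √Real.pi := by
    simpa using integral_gaussian 1
  simp only [one_mul] at h
  rw [h, hg, integral_mul_const, hg, Real.mul_self_sqrt Real.pi_nonneg]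

/-- After the shear the first sign is that of `u + tan s · y`, so the inner integral is an error
function of `tan s · y` and the outer one yields `2 arctan (tan s)`. -/
lemma integral_sgn_sgn_corrWeight {s : ℝ} (hs0 : 0 ≤ s) (hs1 : s < Real.pi / 2) :
    ∫ x : ℝ × ℝ, sgn x.1 * sgn x.2 * corrWeight s x = Real.cos s * (2 * s) := by
  have hc : 0 < Real.cos s := Real.cos_pos_of_mem_Ioo ⟨by linarith, hs1⟩
  have hm : Measurable (Function.uncurry fun x y : ℝ => sgn x * sgn y) :=
    (measurable_sgn.comp measurable_fst).mul (measurable_sgn.comp measurable_snd)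
  have h := integral_corrWeight hc (w := fun x y => sgn x * sgn y) hm
    (fun x y => by rw [abs_mul, abs_sgn, abs_sgn, one_mul])
  rw [h]
  congr 1
  have ht : 0 ≤ Real.tan s := Real.tan_nonneg_of_nonneg_of_le_pi_div_two hs0 hs1.le
  have h2 := integral_sgn_mul_exp_mul_erf ht
  rw [Real.arctan_tan (by linarith) hs1] at h2
  rw [← h2]
  congr 1
  ext y
  rw [← integral_sgn_add_exp, ← integral_const_mul, ← integral_const_mul]
  congr 1
  ext u
  have : sgn (Real.cos s * u + Real.sin s * y) = sgn (u + Real.tan s * y) := by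
    rw [← sgn_mul_pos hc (x := u + Real.tan s * y), Real.tan_eq_sin_div_cos]
    congr 1
    field_simp
  rw [this]
  ring

lemma kern_pairUp_sin (s : ℝ) (r) :
    kern (Real.sin s : ℂ) (pairUp r) = ((corrWeight s r.1 * corrWeight s r.2 : ℝ) : ℂ) := by
  have hc : (1 - (Real.sin s : ℂ) ^ 2) = ((Real.cos s ^ 2 : ℝ) : ℂ) := by
    rw [Real.cos_sq']; push_cast; rfl
  rw [kern, hc, corrWeight, corrWeight, ← Real.exp_add, Complex.ofReal_exp]
  congr 1
  rw [← add_div]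
  push_cast [pairUp]
  congr 1
  ring

lemma signProd_zero_pairUp (r) : signProd 0 (pairUp r) = sgn r.2.1 * sgn r.2.2 := by
  simp [signProd, signAbove, pairUp, sgn]

/-- For `η = 0` the signs involve only the second coordinates, so the first coordinates contribute
the total mass `π cos s` and the rest is the planar sign correlation. -/
lemma H_zero_sin_real {s : ℝ} (hs0 : 0 ≤ s) (hs1 : s < Real.pi / 2) :
    H 0 (Real.sin s : ℂ) = s := by
  have hc : 0 < Real.cos s := Real.cos_pos_of_mem_Ioo ⟨by linarith, hs1⟩
  have hc' : (1 - (Real.sin s : ℂ) ^ 2) = ((Real.cos s ^ 2 : ℝ) : ℂ) := by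
    rw [Real.cos_sq']; push_cast; rfl
  have hI : ∫ q, (signProd 0 q : ℂ) * kern (Real.sin s : ℂ) q =
      ((Real.cos s * Real.pi * (Real.cos s * (2 * s)) : ℝ) : ℂ) := by
    rw [← integral_pairUp, ← integral_corrWeight_one hc, ← integral_sgn_sgn_corrWeight hs0 hs1,
      ← integral_prod_mul, ← integral_complex_ofReal]
    congr 1
    ext r
    rw [kern_pairUp_sin, signProd_zero_pairUp]
    push_cast
    ring
  rw [H_eq, hI, hc']
  have := Real.pi_ne_zero
  have := hc.ne'
  rw [← Complex.ofReal_ofNat, ← Complex.ofReal_mul, ← Complex.ofReal_mul, ← Complex.ofReal_one,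
    ← Complex.ofReal_div, ← Complex.ofReal_mul]
  congr 1
  field_simp

/-- `H 0` is the inverse of the sine on the unit disc. -/
theorem H_zero_sin {v : ℂ} (hv : v ∈ ball (0 : ℂ) 1) : H 0 (Complex.sin v) = v := by
  have hf : AnalyticOnNhd ℂ (fun v => H 0 (Complex.sin v)) (ball 0 1) :=
    (differentiableOn_H_sin 0).analyticOnNhd isOpen_ball
  -- The identity theorem needs agreement only at points accumulating at `0`; small positive reals
  -- serve.
  have ht : Tendsto (fun s : ℝ => (s : ℂ)) (𝓝[>] 0) (𝓝[≠] 0) := by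
    refine tendsto_nhdsWithin_iff.2 ⟨?_, ?_⟩
    · exact (Complex.continuous_ofReal.tendsto' 0 0 rfl).mono_left nhdsWithin_le_nhds
    · filter_upwards [self_mem_nhdsWithin] with s hs
      simpa using (ne_of_gt hs : s ≠ 0)
  have hev : ∀ᶠ s : ℝ in 𝓝[>] 0, H 0 (Complex.sin (s : ℂ)) = s := by
    filter_upwards [Ioo_mem_nhdsGT (show (0 : ℝ) < 1 by norm_num)] with s hs
    rw [← Complex.ofReal_sin]
    exact H_zero_sin_real hs.1.le (hs.2.trans (by linarith [Real.pi_gt_three]))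
  exact hf.eqOn_of_preconnected_of_frequently_eq analyticOnNhd_id
    (convex_ball (0 : ℂ) 1).isPreconnected (mem_ball_self one_pos)
    (ht.frequently hev.frequently) hv

/-! ### The inverse of `F η p` -/

/-- This places `log (1 + √2)`, about `0.881`, below `89/100`, hence inside all the discs in use. -/
lemma one_lt_sinh : 1 < Real.sinh (89 / 100) := by
  have h := Real.sum_le_exp_of_nonneg (show (0 : ℝ) ≤ 89 / 100 by norm_num) 7
  have h1 : (243 / 100 : ℝ) ≤ Real.exp (89 / 100) := by
    refine le_trans ?_ h
    norm_num [Finset.sum_range_succ, Nat.factorial]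
  have h2 : Real.exp (-(89 / 100)) ≤ 100 / 243 := by
    rw [Real.exp_neg]
    calc _ ≤ (243 / 100 : ℝ)⁻¹ := by gcongr
      _ = _ := by norm_num
  rw [Real.sinh_eq]
  linarith

lemma sinh_log_one_add_sqrt_two : Real.sinh (Real.log (1 + √2)) = 1 := by
  have : Real.log (1 + √2) = Real.arsinh 1 := by
    rw [Real.arsinh]; norm_num
  rw [this, Real.sinh_arsinh]

lemma F_sin (η p : ℝ) {v : ℂ} (hv : v ∈ ball (0 : ℂ) 1) :
    F η p (Complex.sin v) = v + p * (H η (Complex.sin v) - v) := by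
  rw [F, H_zero_sin hv]; ring

lemma sin_injOn_ball : InjOn Complex.sin (ball 0 1) := fun v hv w hw h => by
  rw [← H_zero_sin hv, ← H_zero_sin hw, h]

lemma isOpen_sin_image {U : Set ℂ} (hU : IsOpen U) (hU1 : U ⊆ ball 0 1) :
    IsOpen (Complex.sin '' U) := by
  have han : AnalyticOnNhd ℂ Complex.sin (ball 0 1) :=
    Complex.differentiable_sin.differentiableOn.analyticOnNhd isOpen_ball
  rcases han.is_constant_or_isOpen (convex_ball (0 : ℂ) 1).isPreconnected with ⟨w, hw⟩ | h
  · exfalso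
    have h2 : (1 / 2 : ℂ) ∈ ball (0 : ℂ) 1 := by rw [mem_ball_zero_iff]; norm_num
    have h0 : (0 : ℂ) ∈ ball (0 : ℂ) 1 := mem_ball_self one_pos
    have := sin_injOn_ball h2 h0 ((hw _ h2).trans (hw _ h0).symm)
    norm_num at this
  · exact h U hU1 hU

/-- The inverse is the sine of the inverse of `v + p E(v)`, and `Ω` is the sine image of the part of
the disc sent into radius `9/10`. Everything about `η` enters through `t > L`, which makes `E(iL)/i
= t - L` positive. -/
theorem exists_inverse_and_root {η t : ℝ} (ht : H η Complex.I / Complex.I = (t : ℂ))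
    (hlt : Real.log (1 + √2) < t) :
    ∃ p₀ : ℝ, 0 < p₀ ∧ p₀ ≤ 1 ∧ ∀ p ∈ Ioo (0 : ℝ) p₀,
      ball (0 : ℂ) (9 / 10) ⊆ F η p '' strip ∧
      ∃ (Ω : Set ℂ) (G : ℂ → ℂ),
        IsOpen Ω ∧ Bornology.IsBounded Ω ∧ closure Ω ⊆ strip ∧ (0 : ℂ) ∈ Ω ∧
        BijOn (F η p) Ω (ball (0 : ℂ) (9 / 10)) ∧
        InvOn G (F η p) Ω (ball (0 : ℂ) (9 / 10)) ∧
        G 0 = 0 ∧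
        AnalyticOnNhd ℂ G (ball (0 : ℂ) (9 / 10)) ∧
        (∀ z ∈ ball (0 : ℂ) (9 / 10),
          HasSum (fun k : ℕ => taylorCoeff G (k + 1) * z ^ (k + 1)) (G z)) ∧
        ∃ γ : ℝ, 0 ≤ γ ∧ HasSum (fun k : ℕ => ‖taylorCoeff G (k + 1)‖ * γ ^ (k + 1)) 1 ∧
          Real.log (1 + √2) < γ := by
  set L := Real.log (1 + √2) with hL
  have hsL : Real.sinh L = 1 := sinh_log_one_add_sqrt_two
  have hL0 : 0 < L := Real.sinh_pos_iff.1 (by rw [hsL]; exact one_pos)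
  have hL89 : L < 89 / 100 := Real.sinh_lt_sinh.1 (by rw [hsL]; exact one_lt_sinh)
  set E : ℂ → ℂ := fun v => H η (Complex.sin v) - v with hE
  have hEd : DifferentiableOn ℂ E (ball 0 1) := (differentiableOn_H_sin η).sub differentiableOn_id
  have hEneg : ∀ v, E (-v) = -E v := fun v => by
    simp only [hE, Complex.sin_neg, H_neg]; ring
  have hE0 : E 0 = 0 := by
    have := hEneg 0
    rw [neg_zero] at this
    exact self_eq_neg.1 this
  obtain ⟨M, p₁, hM, hp₁, hp₁1, hEM, hinv⟩ := exists_perturbed_inverse hEd hE0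
  have hIL1 : Complex.I * L ∈ ball (0 : ℂ) (95 / 100) := by
    rw [mem_ball_zero_iff, norm_mul, Complex.norm_I, one_mul, Complex.norm_real,
      Real.norm_of_nonneg hL0.le]
    linarith
  have hball : ball (0 : ℂ) (95 / 100) ⊆ ball 0 1 := ball_subset_ball (by norm_num)
  have hball' : ball (0 : ℂ) (97 / 100) ⊆ ball 0 1 := ball_subset_ball (by norm_num)
  have hball9 : ball (0 : ℂ) (9 / 10) ⊆ ball 0 (95 / 100) := ball_subset_ball (by norm_num)
  have hEIL : (E (Complex.I * L) / Complex.I).re = t - L := by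
    have hsin : Complex.sin (Complex.I * L) = Complex.I := by
      rw [mul_comm, Complex.sin_mul_I, ← Complex.ofReal_sinh, hsL]; simp
    simp only [hE, hsin]
    rw [sub_div, ht, mul_div_cancel_left₀ _ Complex.I_ne_zero]
    simp
  obtain ⟨r, hr, hfirst⟩ := re_sin_perturbed_le hM (sub_pos.2 hlt) hsL
    ((hEd.continuousOn.continuousAt (isOpen_ball.mem_nhds (hball hIL1)))) hEIL
  -- A Lipschitz constant for the sine, turning the displacement `|e⁻¹(w) - w| ≤ p M` into `|G -
  -- sin| = O(p)`.
  obtain ⟨C, hC⟩ := (isCompact_closedBall (0 : ℂ) (97 / 100)).exists_bound_of_continuousOn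
    Complex.continuous_cos.continuousOn
  have hC0 : 0 ≤ C := (norm_nonneg _).trans (hC 0 (by simp; norm_num))
  have hlip : ∀ x ∈ ball (0 : ℂ) (97 / 100), ∀ y ∈ ball (0 : ℂ) (97 / 100),
      ‖Complex.sin y - Complex.sin x‖ ≤ C * ‖y - x‖ := fun x hx y hy =>
    (convex_ball (0 : ℂ) (97 / 100)).norm_image_sub_le_of_norm_deriv_le
      (fun z _ => Complex.differentiable_sin z)
      (fun z hz => by rw [Complex.deriv_sin]; exact hC z (ball_subset_closedBall hz)) hx hy
  obtain ⟨p₂, hp₂, hroot⟩ := exists_taylor_norm_root (M := (C + 1) * M) (c := (t - L) / 4) hL0 hL89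
    one_lt_sinh (by positivity) (by linarith)
  -- The bounds serve, in order, invertibility, the root `γ`, and keeping `e.symm (iL)` within `r`
  -- of `iL`.
  refine ⟨min p₁ (min p₂ (r / M)), lt_min hp₁ (lt_min hp₂ (by positivity)),
    (min_le_left _ _).trans hp₁1, fun p hp => ?_⟩
  have hp0 : 0 < p := hp.1
  have hpp₁ : p < p₁ := hp.2.trans_le (min_le_left _ _)
  have hpp₂ : p < p₂ := hp.2.trans_le ((min_le_right _ _).trans (min_le_left _ _))
  have hpr : p < r / M := hp.2.trans_le ((min_le_right _ _).trans (min_le_right _ _))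
  obtain ⟨e, he, hes, het, hed⟩ := hinv p ⟨hp0, hpp₁⟩
  have hV : ∀ w ∈ ball (0 : ℂ) (95 / 100), e.symm w ∈ ball (0 : ℂ) (97 / 100) := fun w hw => by
    rw [← hes]; exact e.map_target (het hw)
  have hVe : ∀ w ∈ ball (0 : ℂ) (95 / 100), e.symm w + p * E (e.symm w) = w := fun w hw => by
    rw [← he]; exact e.right_inv (het hw)
  -- Oddness passes to the inverse by injectivity: the oddness of `E` shows that `-e.symm w` is a
  -- preimage of `-w`.
  have hVneg : ∀ w ∈ ball (0 : ℂ) (95 / 100), e.symm (-w) = -e.symm w := fun w hw => by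
    have h1 : -e.symm w ∈ e.source := by
      rw [hes, mem_ball_zero_iff, norm_neg, ← mem_ball_zero_iff]; exact hV w hw
    rw [← e.left_inv h1, he, hEneg]
    congr 1
    nth_rewrite 1 [← hVe w hw]
    ring
  have hFe : ∀ v ∈ ball (0 : ℂ) (97 / 100), F η p (Complex.sin v) = e v := fun v hv => by
    rw [F_sin η p (hball' hv), he]
  set U := e.source ∩ e ⁻¹' ball 0 (9 / 10) with hU
  have hUo : IsOpen U := e.isOpen_inter_preimage isOpen_ball
  have hUs : U ⊆ ball (0 : ℂ) (97 / 100) := hes ▸ inter_subset_left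
  have hVU : ∀ w ∈ ball (0 : ℂ) (9 / 10), e.symm w ∈ U := fun w hw =>
    ⟨e.map_target (het (hball9 hw)), by
      rw [mem_preimage, e.right_inv (het (hball9 hw))]; exact hw⟩
  set G : ℂ → ℂ := fun w => Complex.sin (e.symm w) with hG
  have hGd : DifferentiableOn ℂ G (ball 0 (95 / 100)) := hed.csin
  have hmaps : MapsTo (F η p) (Complex.sin '' U) (ball 0 (9 / 10)) := by
    rintro _ ⟨v, hv, rfl⟩
    rw [hFe v (hUs hv)]
    exact hv.2
  have hleft : LeftInvOn G (F η p) (Complex.sin '' U) := by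
    rintro _ ⟨v, hv, rfl⟩
    rw [hFe v (hUs hv)]
    simp only [hG, e.left_inv hv.1]
  have hright : RightInvOn G (F η p) (ball 0 (9 / 10)) := fun w hw => by
    simp only [hG]
    rw [hFe _ (hV w (hball9 hw)), e.right_inv (het (hball9 hw))]
  have hGmaps : MapsTo G (ball 0 (9 / 10)) (Complex.sin '' U) := fun w hw =>
    mem_image_of_mem _ (hVU w hw)
  have hbij : BijOn (F η p) (Complex.sin '' U) (ball 0 (9 / 10)) :=
    InvOn.bijOn ⟨hleft, hright⟩ hmaps hGmaps
  have hG0 : G 0 = 0 := by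
    have := hVneg 0 (mem_ball_self (by norm_num))
    rw [neg_zero] at this
    simp only [hG, self_eq_neg.1 this, Complex.sin_zero]
  have hΩsub : Complex.sin '' U ⊆ Complex.sin '' closedBall 0 (97 / 100) :=
    image_mono (hUs.trans ball_subset_closedBall)
  have hcomp : IsCompact (Complex.sin '' closedBall 0 (97 / 100)) :=
    (isCompact_closedBall _ _).image Complex.continuous_sin
  have hcstrip : Complex.sin '' closedBall 0 (97 / 100) ⊆ strip := by
    rintro _ ⟨v, hv, rfl⟩
    exact sin_mem_strip (closedBall_subset_ball (by norm_num) hv)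
  refine ⟨?_, Complex.sin '' U, G, isOpen_sin_image hUo (hUs.trans hball'),
    hcomp.isBounded.subset hΩsub, (closure_minimal hΩsub hcomp.isClosed).trans hcstrip, ?_, hbij,
    ⟨hleft, hright⟩, hG0, (hGd.mono hball9).analyticOnNhd isOpen_ball, ?_, ?_⟩
  · rw [← hbij.image_eq]
    exact image_mono (hΩsub.trans hcstrip)
  · have := hGmaps (mem_ball_self (by norm_num : (0 : ℝ) < 9 / 10))
    rwa [hG0] at this
  · intro z hz
    have h := (hasSum_nat_add_iff' 1).2 (taylorCoeff_hasSum hGd (hball9 hz))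
    have h0 : taylorCoeff G 0 = 0 := by simp [taylorCoeff, hG0]
    simpa [h0] using h
  · refine hroot p ⟨hp0, hpp₂⟩ G hGd (fun z hz => ?_) (fun z hz => ?_) ?_
    · simp only [hG, hVneg z hz, Complex.sin_neg]
    · have hz' : z ∈ ball (0 : ℂ) (97 / 100) := ball_subset_ball (by norm_num) hz
      refine (hlip z hz' _ (hV z hz)).trans ?_
      have h1 : e.symm z - z = -(p * E (e.symm z)) := by
        nth_rewrite 2 [← hVe z hz]; ring
      rw [h1, norm_neg, norm_mul, Complex.norm_real, Real.norm_of_nonneg hp0.le]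
      have := hEM _ (hV z hz)
      calc C * (p * ‖E (e.symm z)‖) ≤ C * (p * M) := by gcongr
        _ ≤ _ := by nlinarith [mul_pos hp0 hM]
    · have h2 : e.symm (Complex.I * L) = Complex.I * L - p * E (e.symm (Complex.I * L)) :=
        eq_sub_of_add_eq (hVe _ hIL1)
      have h3 := hEM _ (hV _ hIL1)
      refine hfirst p hp0 _ ?_ h2 h3
      rw [dist_eq_norm]
      nth_rewrite 1 [h2]
      rw [sub_sub_cancel_left, norm_neg, norm_mul, Complex.norm_real, Real.norm_of_nonneg hp0.le]
      rw [lt_div_iff₀ hM] at hpr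
      calc p * ‖E (e.symm (Complex.I * L))‖ ≤ p * M := by gcongr
        _ < r := hpr

/-! ### Gaussian weights and integration by parts against polynomials -/

/-- The Gaussian weight `exp (-b y² + i t y)`. -/
def wt (b t y : ℝ) : ℂ := Complex.exp (-(b : ℂ) * y ^ 2 + Complex.I * t * y)

lemma norm_wt (b t y : ℝ) : ‖wt b t y‖ = Real.exp (-b * y ^ 2) := by
  rw [wt, Complex.norm_exp]
  congr 1
  have e : -(b : ℂ) * y ^ 2 + Complex.I * t * y =
      ((-b * y ^ 2 : ℝ) : ℂ) + ((t * y : ℝ) : ℂ) * Complex.I := by push_cast; ring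
  rw [e, Complex.add_re, Complex.re_ofReal_mul, Complex.I_re, Complex.ofReal_re, mul_zero, add_zero]

lemma continuous_wt (b t : ℝ) : Continuous (wt b t) := by unfold wt; fun_prop

lemma integrable_pow_mul_exp {b : ℝ} (hb : 0 < b) (n : ℕ) :
    Integrable fun x : ℝ => x ^ n * Real.exp (-b * x ^ 2) := by
  have := integrable_rpow_mul_exp_neg_mul_sq hb (s := n)
    (by have : (0 : ℝ) ≤ n := n.cast_nonneg
        linarith)
  simpa using this

lemma integrable_eval_mul_wt {b : ℝ} (hb : 0 < b) (t : ℝ) (p : ℂ[X]) :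
    Integrable fun y : ℝ => p.eval (y : ℂ) * wt b t y := by
  induction p using Polynomial.induction_on' with
  | add p q hp hq =>
    refine (hp.add hq).congr (Eventually.of_forall fun y => ?_)
    simp [add_mul]
  | monomial n a =>
    refine ((integrable_pow_mul_exp hb n).norm.const_mul ‖a‖).mono' ?_
      (Eventually.of_forall fun y => le_of_eq ?_)
    · have := continuous_wt b t
      exact Continuous.aestronglyMeasurable (by fun_prop)
    · rw [norm_mul, norm_wt, eval_monomial, norm_mul, norm_mul, norm_pow, norm_pow,
        Complex.norm_real, Real.norm_of_nonneg (Real.exp_nonneg _), mul_assoc]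

lemma hasDerivAt_wt (b t y : ℝ) :
    HasDerivAt (wt b t) ((-2 * b * y + Complex.I * t) * wt b t y) y := by
  have h : HasDerivAt (fun z : ℂ => -(b : ℂ) * z ^ 2 + Complex.I * t * z)
      (-2 * b * y + Complex.I * t) (y : ℂ) := by
    refine (((hasDerivAt_pow 2 (y : ℂ)).const_mul _).add
      ((hasDerivAt_id (y : ℂ)).const_mul _)).congr_deriv ?_
    push_cast
    ring
  have := h.cexp.comp_ofReal
  refine this.congr_deriv ?_
  rw [wt]
  ring

/-- Integration by parts, in the form of a certificate `p = c + (q wt)' / wt`. -/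
lemma integral_eval_mul_wt {b t : ℝ} (hb : 0 < b) (p q : ℂ[X]) (c : ℂ)
    (h : ∀ y : ℂ, p.eval y = c + (q.derivative.eval y + (-2 * b * y + Complex.I * t) * q.eval y)) :
    ∫ y : ℝ, p.eval (y : ℂ) * wt b t y = c * ∫ y, wt b t y := by
  have hd : ∀ y : ℝ, HasDerivAt (fun y : ℝ => q.eval (y : ℂ) * wt b t y)
      ((p - C c).eval (y : ℂ) * wt b t y) y := fun y => by
    refine (((q.hasDerivAt (y : ℂ)).comp_ofReal).mul (hasDerivAt_wt b t y)).congr_deriv ?_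
    rw [eval_sub, eval_C, h]
    ring
  have h0 := integral_eq_zero_of_hasDerivAt_of_integrable hd (integrable_eval_mul_wt hb t _)
    (integrable_eval_mul_wt hb t q)
  have h1 := integrable_eval_mul_wt hb t (C c)
  simp only [eval_sub, sub_mul] at h0
  rw [integral_sub (integrable_eval_mul_wt hb t p) h1, sub_eq_zero] at h0
  rw [h0]
  simp only [eval_C]
  rw [integral_const_mul]

/-- Proportional to the fifth Hermite polynomial. -/
def hermPoly : ℂ[X] := 4 * X ^ 5 - 20 * X ^ 3 + 15 * X

/-- The transform of `hermPoly ^ 2`. -/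
def hermSqTransform : ℂ[X] :=
  4545 - 28425 * X ^ 2 + 24000 * X ^ 4 - 6120 * X ^ 6 + 560 * X ^ 8 - 16 * X ^ 10

/-- The fifth Hermite function is an eigenfunction of the Fourier transform, with eigenvalue `i⁵ =
i`. -/
lemma integral_hermPoly_mul_wt (x : ℝ) :
    ∫ y : ℝ, hermPoly.eval (y : ℂ) * wt (1 / 2) x y =
      Complex.I * hermPoly.eval (x : ℂ) * ∫ y, wt (1 / 2) x y := by
  set u : ℂ := Complex.I * x with hu
  have e : Complex.I * hermPoly.eval (x : ℂ) = 15 * u + 20 * u ^ 3 + 4 * u ^ 5 := by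
    simp only [hermPoly, hu, eval_add, eval_sub, eval_mul, eval_pow, eval_X, eval_ofNat, mul_pow,
      Complex.I_pow_three, show Complex.I ^ 5 = Complex.I by
        rw [show 5 = 4 + 1 from rfl, pow_succ, Complex.I_pow_four, one_mul]]
    ring
  rw [e]
  refine integral_eval_mul_wt (by norm_num) _
    -- The certificate follows by matching powers of `y` from the top down; what is left over is the
    -- constant `c`, a polynomial in `u = ix`.
    (-4 * X ^ 4 - 4 * C u * X ^ 3 + (4 - 4 * C u ^ 2) * X ^ 2 + (-8 * C u - 4 * C u ^ 3) * X
      + (-7 - 16 * C u ^ 2 - 4 * C u ^ 4)) _ fun y => ?_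
  rw [← hu]
  simp [hermPoly, derivative_pow]
  ring

lemma integral_hermPoly_sq_mul_wt (x : ℝ) :
    ∫ y : ℝ, (hermPoly ^ 2).eval (y : ℂ) * wt (1 / 2) x y =
      hermSqTransform.eval (x : ℂ) * ∫ y, wt (1 / 2) x y := by
  set u : ℂ := Complex.I * x with hu
  have e : hermSqTransform.eval (x : ℂ) = 4545 + 28425 * u ^ 2 + 24000 * u ^ 4 + 6120 * u ^ 6 +
      560 * u ^ 8 + 16 * u ^ 10 := by
    have h2 : u ^ 2 = -(x : ℂ) ^ 2 := by rw [hu, mul_pow, Complex.I_sq]; ring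
    rw [show u ^ 4 = (u ^ 2) ^ 2 by ring, show u ^ 6 = (u ^ 2) ^ 3 by ring,
      show u ^ 8 = (u ^ 2) ^ 4 by ring, show u ^ 10 = (u ^ 2) ^ 5 by ring, h2]
    simp only [hermSqTransform, eval_add, eval_sub, eval_mul, eval_pow, eval_X, eval_ofNat]
    ring
  rw [e]
  refine integral_eval_mul_wt (by norm_num) _
    (-16 * X ^ 9 - 16 * C u * X ^ 8 + (16 - 16 * C u ^ 2) * X ^ 7
      - (112 * C u + 16 * C u ^ 3) * X ^ 6
      - (408 + 224 * C u ^ 2 + 16 * C u ^ 4) * X ^ 5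
      - (1080 * C u + 320 * C u ^ 3 + 16 * C u ^ 5) * X ^ 4
      - (1440 + 2200 * C u ^ 2 + 400 * C u ^ 4 + 16 * C u ^ 6) * X ^ 3
      - (5760 * C u + 3480 * C u ^ 3 + 464 * C u ^ 5 + 16 * C u ^ 7) * X ^ 2
      - (4545 + 12360 * C u ^ 2 + 4680 * C u ^ 4 + 512 * C u ^ 6 + 16 * C u ^ 8) * X
      - (16065 * C u + 19320 * C u ^ 3 + 5608 * C u ^ 5 + 544 * C u ^ 7 + 16 * C u ^ 9)) _
    fun y => ?_
  rw [← hu]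
  simp [hermPoly, derivative_pow]
  ring

/-- Up to positive factors this is the coefficient of order four in the expansion; its positivity
decides the theorem. -/
lemma integral_quartic_mul_wt :
    ∫ y : ℝ, (hermPoly ^ 4 + 3 * (hermPoly ^ 2 * hermSqTransform)).eval (y : ℂ) * wt 1 0 y =
      17280000 * ∫ y, wt 1 0 y := by
  refine integral_eval_mul_wt one_pos _
    (256 * X ^ 19 - 12288 * X ^ 17 + 168192 * X ^ 15 - 1141760 * X ^ 13 + 4068960 * X ^ 11
      - 8620800 * X ^ 9 + 7837200 * X ^ 7 - 9662400 * X ^ 5 - 10497375 * X ^ 3 - 17280000 * X) _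
    fun y => ?_
  simp [hermPoly, hermSqTransform]
  ring

lemma integral_wt_one_zero : ∫ y, wt 1 0 y = (√Real.pi : ℂ) := by
  have h : ∫ y : ℝ, Real.exp (-1 * y ^ 2) = √Real.pi := by simpa using integral_gaussian 1
  rw [← h, ← integral_complex_ofReal]
  congr 1
  ext y
  simp [wt]

lemma integral_wt_half (x : ℝ) :
    ∫ y, wt (1 / 2) x y =
      ((√(2 * Real.pi) * Real.exp (-(1 / 2) * x ^ 2) : ℝ) : ℂ) := by
  have h := integral_cexp_quadratic (b := -(1 / 2 : ℂ)) (by norm_num) (Complex.I * x) 0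
  have e : ∀ y : ℝ, wt (1 / 2) x y =
      Complex.exp (-(1 / 2 : ℂ) * y ^ 2 + Complex.I * x * y + 0) := fun y => by
    rw [wt, add_zero]; push_cast; rfl
  simp_rw [e]
  rw [h]
  have h1 : (Real.pi / - -(1 / 2 : ℂ)) ^ (1 / 2 : ℂ) = ((√(2 * Real.pi) : ℝ) : ℂ) := by
    rw [Real.sqrt_eq_rpow, Complex.ofReal_cpow (by positivity)]
    congr 1
    · push_cast; ring
    · push_cast; ring
  rw [h1]
  push_cast
  congr 2
  rw [mul_pow, Complex.I_sq]
  ring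

/-- The two-dimensional kernel, at the point `i`. -/
def ker2 (x y : ℝ) : ℂ := Real.exp (-(1 / 2) * x ^ 2) * wt (1 / 2) x y

lemma ker2_eq (x y : ℝ) :
    ker2 x y = Complex.exp (-((x : ℂ) ^ 2 + y ^ 2) / 2 + Complex.I * (x * y)) := by
  rw [ker2, wt, Complex.ofReal_exp, ← Complex.exp_add]
  congr 1
  push_cast
  ring

lemma ker2_comm (x y : ℝ) : ker2 x y = ker2 y x := by
  rw [ker2_eq, ker2_eq]; congr 1; ring

lemma norm_ker2 (x y : ℝ) :
    ‖ker2 x y‖ = Real.exp (-(1 / 2) * x ^ 2) * Real.exp (-(1 / 2) * y ^ 2) := by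
  rw [ker2, norm_mul, norm_wt, Complex.norm_real, Real.norm_of_nonneg (Real.exp_nonneg _)]

lemma continuous_ker2 : Continuous (Function.uncurry ker2) := by
  have : Function.uncurry ker2 = fun r : ℝ × ℝ =>
      Complex.exp (-((r.1 : ℂ) ^ 2 + r.2 ^ 2) / 2 + Complex.I * (r.1 * r.2)) := by
    ext r; exact ker2_eq _ _
  rw [this]
  fun_prop

lemma integrable_norm_eval_mul_exp (p : ℂ[X]) :
    Integrable fun x : ℝ => ‖p.eval (x : ℂ)‖ * Real.exp (-(1 / 2) * x ^ 2) := by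
  refine (integrable_eval_mul_wt (b := 1 / 2) (by norm_num) 0 p).norm.congr
    (Eventually.of_forall fun y => ?_)
  simp only [norm_mul, norm_wt]

lemma integrable_eval_eval_mul_ker2 (p q : ℂ[X]) :
    Integrable fun r : ℝ × ℝ => p.eval (r.1 : ℂ) * q.eval (r.2 : ℂ) * ker2 r.1 r.2 := by
  refine ((integrable_norm_eval_mul_exp p).mul_prod (integrable_norm_eval_mul_exp q)).mono' ?_
    (Eventually.of_forall fun r => le_of_eq ?_)
  · have := continuous_ker2
    simp only [Function.uncurry_def] at this
    exact Continuous.aestronglyMeasurable (by fun_prop)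
  · rw [norm_mul, norm_mul, norm_ker2]; ring

/-- The bilinear form on polynomials given by the kernel at `i`. -/
def kerForm (p q : ℂ[X]) : ℂ :=
  ∫ r : ℝ × ℝ, p.eval (r.1 : ℂ) * q.eval (r.2 : ℂ) * ker2 r.1 r.2

lemma kerForm_comm (p q : ℂ[X]) : kerForm p q = kerForm q p := by
  rw [kerForm, kerForm, Measure.volume_eq_prod, ← integral_prod_swap]
  congr 1
  ext r
  simp only [Prod.fst_swap, Prod.snd_swap]
  rw [ker2_comm]
  ring

/-- Integrating out `y` reproduces `exp (-x²/2)`, which combines with the same factor of the kernel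
to the weight `exp (-x²)`. -/
lemma kerForm_eq {p q T : ℂ[X]}
    (hT : ∀ x : ℝ, ∫ y : ℝ, q.eval (y : ℂ) * wt (1 / 2) x y =
      T.eval (x : ℂ) * ∫ y, wt (1 / 2) x y) :
    kerForm p q = (√(2 * Real.pi) : ℂ) * ∫ x : ℝ, (p * T).eval (x : ℂ) * wt 1 0 x := by
  rw [kerForm, Measure.volume_eq_prod, integral_prod _ (integrable_eval_eval_mul_ker2 p q),
    ← integral_const_mul]
  congr 1
  ext x
  have h : ∀ y : ℝ, p.eval (x : ℂ) * q.eval (y : ℂ) * ker2 x y =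
      p.eval (x : ℂ) * Real.exp (-(1 / 2) * x ^ 2) * (q.eval (y : ℂ) * wt (1 / 2) x y) :=
    fun y => by rw [ker2]; ring
  simp only [h]
  rw [integral_const_mul, hT, integral_wt_half, eval_mul]
  have hw : wt 1 0 x = ((Real.exp (-(1 / 2) * x ^ 2) * Real.exp (-(1 / 2) * x ^ 2) : ℝ) : ℂ) := by
    rw [← Real.exp_add, wt, Complex.ofReal_exp]
    congr 1
    push_cast
    ring
  rw [hw]
  push_cast
  ring

lemma kerForm_one (p : ℂ[X]) :
    kerForm p 1 = (√(2 * Real.pi) : ℂ) * ∫ x : ℝ, p.eval (x : ℂ) * wt 1 0 x := by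
  rw [kerForm_eq (T := 1) (fun x => by simp), mul_one]

lemma kerForm_hermPoly (p : ℂ[X]) :
    kerForm p hermPoly =
      Complex.I * ((√(2 * Real.pi) : ℂ) * ∫ x : ℝ, (p * hermPoly).eval (x : ℂ) * wt 1 0 x) := by
  have h : ∫ x : ℝ, (p * (C Complex.I * hermPoly)).eval (x : ℂ) * wt 1 0 x =
      Complex.I * ∫ x : ℝ, (p * hermPoly).eval (x : ℂ) * wt 1 0 x := by
    rw [← integral_const_mul]
    congr 1
    ext x
    simp only [eval_mul, eval_C]
    ring
  rw [kerForm_eq (T := C Complex.I * hermPoly)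
    (fun x => by rw [integral_hermPoly_mul_wt, eval_mul, eval_C]), h]
  ring

/-- The second order terms of the expansion cancel. -/
lemma kerForm_second_order :
    -2 * Complex.I * (kerForm (hermPoly ^ 2) 1 + kerForm 1 (hermPoly ^ 2)) +
      4 * kerForm hermPoly hermPoly = 0 := by
  -- Both kinds of term are multiples of the same moment, with coefficients `-2i · 2` and `4 · i`.
  rw [kerForm_comm 1, kerForm_one, kerForm_hermPoly, ← sq]
  ring

/-- The fourth order terms of the expansion. -/
lemma kerForm_fourth_order :
    5 * Complex.I / 6 * (kerForm (hermPoly ^ 4) 1 + kerForm 1 (hermPoly ^ 4)) -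
      2 / 3 * (kerForm (hermPoly ^ 3) hermPoly + kerForm hermPoly (hermPoly ^ 3)) +
      Complex.I * kerForm (hermPoly ^ 2) (hermPoly ^ 2) =
    Complex.I * ((√(2 * Real.pi) * (5760000 * √Real.pi) : ℝ) : ℂ) := by
  have h1 := integral_quartic_mul_wt
  have h2 : ∀ y : ℝ, (hermPoly ^ 4 + 3 * (hermPoly ^ 2 * hermSqTransform)).eval (y : ℂ) * wt 1 0 y
      = (hermPoly ^ 4).eval (y : ℂ) * wt 1 0 y +
        3 * ((hermPoly ^ 2 * hermSqTransform).eval (y : ℂ) * wt 1 0 y) := fun y => by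
    rw [eval_add, eval_mul (p := 3), eval_ofNat]; ring
  simp_rw [h2] at h1
  rw [integral_add (integrable_eval_mul_wt one_pos _ _)
    ((integrable_eval_mul_wt one_pos _ _).const_mul _), integral_const_mul,
    integral_wt_one_zero] at h1
  rw [kerForm_comm 1, kerForm_comm hermPoly, kerForm_one, kerForm_hermPoly, ← pow_succ,
    kerForm_eq integral_hermPoly_sq_mul_wt]
  push_cast
  -- The moment of `hermPoly ^ 4` carries `5i/3 - 4i/3 = i/3` and the mixed term carries `i`, hence
  -- the weights `1` and `3` in the quartic integral.
  linear_combination (Complex.I * (√(2 * Real.pi) : ℂ) / 3) * h1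

/-! ### Moving the sign changes of the kernel -/

/-- The abbreviated Gaussian `exp (-x² / 2)`. -/
def gauss (x : ℝ) : ℝ := Real.exp (-(1 / 2) * x ^ 2)

lemma gauss_nonneg (x : ℝ) : 0 ≤ gauss x := Real.exp_nonneg _

lemma gauss_le_one (x : ℝ) : gauss x ≤ 1 := by
  rw [gauss, Real.exp_le_one_iff]
  nlinarith [sq_nonneg x]

lemma continuous_gauss : Continuous gauss := by unfold gauss; fun_prop

lemma integrable_gauss : Integrable gauss := integrable_exp_neg_mul_sq (by norm_num)

lemma norm_ker2' (x y : ℝ) : ‖ker2 x y‖ = gauss x * gauss y := norm_ker2 x y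

lemma norm_sgn_smul (x : ℝ) (z : ℂ) : ‖sgn x • z‖ = ‖z‖ := by
  rw [norm_smul, Real.norm_eq_abs, abs_sgn, one_mul]

lemma integrable_ker2_left (y : ℝ) : Integrable fun x => ker2 x y := by
  refine (integrable_gauss.mul_const (gauss y)).mono'
    (continuous_ker2.comp (by fun_prop : Continuous fun x : ℝ => (x, y))).aestronglyMeasurable
    (Eventually.of_forall fun x => (norm_ker2' x y).le)

/-- The transform of the sign function. -/
def halfInt (y : ℝ) : ℂ := ∫ x, sgn x • ker2 x y

/-- The integral of the kernel against a product of two signs. -/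
def signInt (a b : ℝ) : ℂ := ∫ r : ℝ × ℝ, (sgn (r.1 - a) * sgn (r.2 - b)) • ker2 r.1 r.2

lemma integrable_sgn_ker2 {w : ℝ × ℝ → ℝ} (hw : Measurable w) (hb : ∀ r, |w r| = 1) :
    Integrable fun r : ℝ × ℝ => w r • ker2 r.1 r.2 := by
  refine (integrable_gauss.mul_prod integrable_gauss).mono'
    (hw.aestronglyMeasurable.smul continuous_ker2.aestronglyMeasurable)
    (Eventually.of_forall fun r => ?_)
  rw [norm_smul, Real.norm_eq_abs, hb, one_mul]
  exact (norm_ker2' _ _).le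

lemma integrable_halfInt : Integrable halfInt :=
  (integrable_sgn_ker2 (w := fun r => sgn r.1) (measurable_sgn.comp measurable_fst)
    (fun _ => abs_sgn _)).integral_prod_right

/-- The integral of the kernel over a segment. -/
def segInt (a y : ℝ) : ℂ := ∫ x in (0 : ℝ)..a, ker2 x y

lemma continuous_segInt (a : ℝ) : Continuous (segInt a) := by
  refine intervalIntegral.continuous_parametric_intervalIntegral_of_continuous' ?_ 0 a
  exact continuous_ker2.comp continuous_swap

lemma integrable_segInt (a : ℝ) : Integrable (segInt a) := by
  refine (integrable_gauss.mul_const |a|).mono' (continuous_segInt a).aestronglyMeasurable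
    (Eventually.of_forall fun y => ?_)
  have := intervalIntegral.norm_integral_le_of_norm_le_const (a := 0) (b := a)
    (f := fun x => ker2 x y) (C := gauss y) fun x _ => by
      rw [norm_ker2']
      exact mul_le_of_le_one_left (gauss_nonneg y) (gauss_le_one x)
  rwa [sub_zero] at this

lemma integral_sgn_sub {f : ℝ → ℂ} (hf : Integrable f) (a : ℝ) :
    ∫ u, sgn (u - a) • f u = (∫ u, sgn u • f u) - 2 * ∫ u in (0 : ℝ)..a, f u := by
  have := integral_sgn_add_mul hf (-a)
  simp only [← sub_eq_add_neg, neg_neg] at this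
  rw [this, intervalIntegral.integral_symm, smul_neg, sub_eq_add_neg, Complex.real_smul]
  push_cast
  rfl

lemma integral_sgn_segInt (a : ℝ) :
    ∫ y, sgn y • segInt a y = ∫ x in (0 : ℝ)..a, halfInt x := by
  have h1 : ∀ y, sgn y • segInt a y = ∫ x in (0 : ℝ)..a, sgn y • ker2 y x := fun y => by
    rw [intervalIntegral.integral_smul, segInt]
    simp_rw [ker2_comm y]
  simp_rw [h1, halfInt]
  refine (intervalIntegral_integral_swap ?_).symm
  refine ((integrable_gauss.restrict (s := uIoc 0 a)).mul_prod integrable_gauss).mono' ?_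
    (Eventually.of_forall fun r => ?_)
  · exact ((measurable_sgn.comp measurable_snd).smul
      (continuous_ker2.comp continuous_swap).measurable).aestronglyMeasurable
  · simp only [Function.uncurry]
    rw [norm_sgn_smul, norm_ker2', mul_comm]

/-- Moving the two jumps from `0` to `a` and `b` changes the integral over two strips, with a
correction over the rectangle where they overlap. By symmetry of the kernel both strips involve
`halfInt`. -/
lemma signInt_eq (a b : ℝ) :
    signInt a b = signInt 0 0 - 2 * (∫ x in (0 : ℝ)..a, halfInt x)
      - 2 * (∫ x in (0 : ℝ)..b, halfInt x) + 4 * ∫ y in (0 : ℝ)..b, segInt a y := by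
  have key : ∀ a b, signInt a b = (∫ y, sgn y • halfInt y) - 2 * (∫ x in (0 : ℝ)..a, halfInt x)
      - 2 * (∫ x in (0 : ℝ)..b, halfInt x) + 4 * ∫ y in (0 : ℝ)..b, segInt a y := by
    intro a b
    have hm : Measurable fun r : ℝ × ℝ => sgn (r.1 - a) * sgn (r.2 - b) :=
      (measurable_sgn.comp (measurable_fst.sub_const a)).mul
        (measurable_sgn.comp (measurable_snd.sub_const b))
    have hint := integrable_sgn_ker2 hm fun r => by rw [abs_mul, abs_sgn, abs_sgn, one_mul]
    rw [signInt, Measure.volume_eq_prod, integral_prod_symm _ hint]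
    have h1 : ∀ y, ∫ x, (sgn (x - a) * sgn (y - b)) • ker2 x y =
        sgn (y - b) • (halfInt y - 2 * segInt a y) := fun y => by
      rw [halfInt, segInt, ← integral_sgn_sub (integrable_ker2_left y), ← integral_smul]
      congr 1
      ext x
      rw [mul_comm, mul_smul]
    simp only [h1]
    have hsub : Integrable fun y => halfInt y - 2 * segInt a y :=
      integrable_halfInt.sub ((integrable_segInt a).const_mul 2)
    rw [integral_sgn_sub hsub]
    have hA : Integrable fun y => sgn y • halfInt y :=
      integrable_halfInt.norm.mono'
        (measurable_sgn.aestronglyMeasurable.smul integrable_halfInt.aestronglyMeasurable)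
        (Eventually.of_forall fun y => (norm_sgn_smul _ _).le)
    have hK : Integrable fun y => sgn y • segInt a y :=
      (integrable_segInt a).norm.mono'
        (measurable_sgn.aestronglyMeasurable.smul (integrable_segInt a).aestronglyMeasurable)
        (Eventually.of_forall fun y => (norm_sgn_smul _ _).le)
    have h2 : ∀ y, sgn y • (halfInt y - 2 * segInt a y) =
        sgn y • halfInt y - 2 * (sgn y • segInt a y) := fun y => by
      rw [smul_sub, mul_smul_comm]
    simp_rw [h2]
    rw [integral_sub hA (hK.const_mul 2), integral_const_mul, integral_sgn_segInt,
      intervalIntegral.integral_sub integrable_halfInt.intervalIntegrable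
        ((integrable_segInt a).const_mul 2).intervalIntegrable,
      intervalIntegral.integral_const_mul]
    ring
  have h0 := key 0 0
  simp only [intervalIntegral.integral_same, mul_zero, sub_zero, add_zero] at h0
  rw [key a b, h0]

/-! ### Taylor expansion of the sign integrals -/

/-- The bound must be global, because the jumps sit at values of an unbounded polynomial; for large
`w` it holds because `|exp w| ≤ 1`. -/
lemma norm_exp_sub_one_sub_le {w : ℂ} (hw : w.re ≤ 0) : ‖Complex.exp w - 1 - w‖ ≤ 3 * ‖w‖ ^ 2 := by
  rcases le_or_gt ‖w‖ 1 with h | h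
  · exact (Complex.norm_exp_sub_one_sub_id_le h).trans (by nlinarith [sq_nonneg ‖w‖])
  · have h1 : ‖Complex.exp w‖ ≤ 1 := by rw [Complex.norm_exp]; exact Real.exp_le_one_iff.2 hw
    calc _ ≤ ‖Complex.exp w‖ + ‖(1 : ℂ)‖ + ‖w‖ :=
          (norm_sub_le _ _).trans (add_le_add_left (norm_sub_le _ _) _)
      _ ≤ 3 * ‖w‖ ^ 2 := by rw [norm_one]; nlinarith

lemma abs_sin_sub_le (t : ℝ) : |Real.sin t - (t - t ^ 3 / 6)| ≤ 3 * t ^ 4 := by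
  rcases le_or_gt |t| 1 with h | h
  · refine (Real.sin_bound h).trans ?_
    have : |t| ^ 5 ≤ |t| ^ 4 := pow_le_pow_of_le_one (abs_nonneg t) h (by norm_num)
    have h4 : |t| ^ 4 = t ^ 4 := by rw [← abs_pow, abs_of_nonneg (by positivity)]
    rw [h4] at this
    have : 0 ≤ t ^ 4 := by positivity
    linarith
  · have h4 : |t| ^ 4 = t ^ 4 := by rw [← abs_pow, abs_of_nonneg (by positivity)]
    have h1 : |Real.sin t - (t - t ^ 3 / 6)| ≤ 1 + (|t| + |t| ^ 3 / 6) := by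
      refine (abs_sub _ _).trans (add_le_add (Real.abs_sin_le_one t) ?_)
      refine (abs_sub _ _).trans (le_of_eq ?_)
      rw [abs_div, abs_pow, abs_of_pos (by norm_num : (0 : ℝ) < 6)]
    have h2 : 1 ≤ |t| ^ 4 := one_le_pow₀ h.le
    have h3 : |t| ≤ |t| ^ 4 := le_self_pow₀ h.le (by norm_num)
    have h5 : |t| ^ 3 ≤ |t| ^ 4 := pow_le_pow_right₀ h.le (by norm_num)
    rw [← h4]
    linarith

/-- The sine transform of a Gaussian on the half line, doubled. -/
def sinInt (y : ℝ) : ℝ := ∫ x, sgn x • (Real.sin (x * y) * gauss x)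

lemma integrable_sgn_smul_mul_gauss {f : ℝ → ℝ} (hf : Continuous f) (hb : ∀ x, |f x| ≤ 1) :
    Integrable fun x => sgn x • (f x * gauss x) := by
  refine integrable_gauss.mono' (measurable_sgn.aestronglyMeasurable.smul
    ((hf.mul continuous_gauss).aestronglyMeasurable)) (Eventually.of_forall fun x => ?_)
  rw [norm_smul, Real.norm_eq_abs, abs_sgn, one_mul, norm_mul, Real.norm_eq_abs,
    Real.norm_of_nonneg (gauss_nonneg x)]
  exact mul_le_of_le_one_left (gauss_nonneg x) (hb x)

lemma integrable_sgn_sin (y : ℝ) : Integrable fun x => sgn x • (Real.sin (x * y) * gauss x) :=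
  integrable_sgn_smul_mul_gauss (f := fun x => Real.sin (x * y)) (by fun_prop)
    fun _ => Real.abs_sin_le_one _

lemma integrable_sgn_cos (y : ℝ) : Integrable fun x => sgn x • (Real.cos (x * y) * gauss x) :=
  integrable_sgn_smul_mul_gauss (f := fun x => Real.cos (x * y)) (by fun_prop)
    fun _ => Real.abs_cos_le_one _

/-- The cosine part of the kernel is even in `x` and integrates to zero against the sign. -/
lemma halfInt_eq (y : ℝ) : halfInt y = Complex.I * ((gauss y * sinInt y : ℝ) : ℂ) := by
  have hk : ∀ x, sgn x • ker2 x y =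
      (gauss y : ℂ) * ((sgn x • (Real.cos (x * y) * gauss x) : ℝ) : ℂ) +
        Complex.I * gauss y * ((sgn x • (Real.sin (x * y) * gauss x) : ℝ) : ℂ) := by
    intro x
    have h1 : ker2 x y = (gauss x : ℂ) * gauss y *
        (Complex.cos (x * y) + Complex.sin (x * y) * Complex.I) := by
      rw [← Complex.exp_mul_I, ker2_eq, gauss, gauss, Complex.ofReal_exp, Complex.ofReal_exp,
        ← Complex.exp_add, ← Complex.exp_add]
      congr 1
      push_cast
      ring
    rw [h1, Complex.real_smul, smul_eq_mul, smul_eq_mul]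
    push_cast
    ring
  have h0 : ∫ x, sgn x • (Real.cos (x * y) * gauss x) = 0 :=
    integral_sgn_mul_even fun x => by simp [gauss]
  rw [halfInt]
  simp_rw [hk]
  rw [integral_add ((integrable_sgn_cos y).ofReal.const_mul _)
    ((integrable_sgn_sin y).ofReal.const_mul _), integral_const_mul,
    integral_const_mul, integral_complex_ofReal, integral_complex_ofReal, h0, sinInt]
  push_cast
  ring

lemma integrable_pow_mul_gauss (n : ℕ) : Integrable fun x => x ^ n * gauss x :=
  integrable_pow_mul_exp (by norm_num) n

lemma integral_abs_mul_gauss : ∫ x, |x| * gauss x = 2 := by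
  have := integral_abs_mul_exp (b := 1 / 2) (by norm_num)
  simp only [gauss]
  rw [this]
  norm_num

lemma integral_abs_pow_three_mul_gauss : ∫ x, |x| ^ 3 * gauss x = 4 := by
  have h1 : ∫ x, |x| ^ 3 * gauss x = 2 * ∫ y in Ioi (0 : ℝ), y ^ 3 * gauss y := by
    have := integral_comp_abs (f := fun y : ℝ => y ^ 3 * gauss y)
    simpa [gauss, sq_abs] using this
  have h2 := integral_rpow_mul_exp_neg_mul_rpow (p := 2) (q := 3) (b := 1 / 2) (by norm_num)
    (by norm_num) (by norm_num)
  have e : ∫ y in Ioi (0 : ℝ), y ^ 3 * gauss y =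
      ∫ y in Ioi (0 : ℝ), y ^ (3 : ℝ) * Real.exp (-(1 / 2) * y ^ (2 : ℝ)) := by
    simp only [gauss]
    norm_cast
  rw [h1, e, h2]
  norm_num

lemma integrable_sgn_smul_pow_mul_gauss (n : ℕ) :
    Integrable fun x => sgn x * (x ^ n * gauss x) := by
  refine (integrable_pow_mul_gauss n).norm.mono' (measurable_sgn.aestronglyMeasurable.mul
    (integrable_pow_mul_gauss n).aestronglyMeasurable) (Eventually.of_forall fun x => ?_)
  rw [norm_mul, Real.norm_eq_abs (sgn x), abs_sgn, one_mul]

lemma abs_sinInt_sub_le (y : ℝ) :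
    |sinInt y - (2 * y - 2 / 3 * y ^ 3)| ≤ 3 * (∫ x, x ^ 4 * gauss x) * y ^ 4 := by
  have i1 : ∫ x, sgn x * (x ^ 1 * gauss x) = 2 := by
    rw [← integral_abs_mul_gauss]
    congr 1; ext x
    rw [← sgn_mul_self]; ring
  have i3 : ∫ x, sgn x * (x ^ 3 * gauss x) = 4 := by
    rw [← integral_abs_pow_three_mul_gauss]
    congr 1; ext x
    rw [pow_succ |x|, sq_abs, ← sgn_mul_self]; ring
  have hI : Integrable fun x =>
      y * (sgn x * (x ^ 1 * gauss x)) - y ^ 3 / 6 * (sgn x * (x ^ 3 * gauss x)) :=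
    ((integrable_sgn_smul_pow_mul_gauss 1).const_mul y).sub
      ((integrable_sgn_smul_pow_mul_gauss 3).const_mul (y ^ 3 / 6))
  have h3 : 2 * y - 2 / 3 * y ^ 3 =
      ∫ x, (y * (sgn x * (x ^ 1 * gauss x)) - y ^ 3 / 6 * (sgn x * (x ^ 3 * gauss x))) := by
    rw [integral_sub ((integrable_sgn_smul_pow_mul_gauss 1).const_mul y)
      ((integrable_sgn_smul_pow_mul_gauss 3).const_mul (y ^ 3 / 6)), integral_const_mul,
      integral_const_mul, i1, i3]
    ring
  rw [h3, sinInt, ← integral_sub (integrable_sgn_sin y) hI, ← Real.norm_eq_abs]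
  refine (norm_integral_le_of_norm_le (((integrable_pow_mul_gauss 4).const_mul (3 * y ^ 4)))
    (Eventually.of_forall fun x => ?_)).trans (le_of_eq ?_)
  · have e : sgn x • (Real.sin (x * y) * gauss x) -
        (y * (sgn x * (x ^ 1 * gauss x)) - y ^ 3 / 6 * (sgn x * (x ^ 3 * gauss x))) =
        sgn x * ((Real.sin (x * y) - (x * y - (x * y) ^ 3 / 6)) * gauss x) := by
      rw [smul_eq_mul]; ring
    rw [e, norm_mul, Real.norm_eq_abs, abs_sgn, one_mul, norm_mul, Real.norm_eq_abs,
      Real.norm_of_nonneg (gauss_nonneg x)]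
    calc _ ≤ 3 * (x * y) ^ 4 * gauss x := by
          have := gauss_nonneg x
          gcongr
          exact abs_sin_sub_le _
      _ = _ := by ring
  · rw [integral_const_mul]; ring

lemma abs_gauss_sub_le (y : ℝ) : |gauss y - (1 - y ^ 2 / 2)| ≤ 3 / 4 * y ^ 4 := by
  have := norm_exp_sub_one_sub_le (w := ((-(1 / 2) * y ^ 2 : ℝ) : ℂ)) (by
    rw [Complex.ofReal_re]; nlinarith [sq_nonneg y])
  rw [← Complex.ofReal_exp, ← Complex.ofReal_one, ← Complex.ofReal_sub, ← Complex.ofReal_sub,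
    Complex.norm_real, Complex.norm_real, Real.norm_eq_abs, Real.norm_eq_abs, sq_abs] at this
  calc _ = |Real.exp (-(1 / 2) * y ^ 2) - 1 - -(1 / 2) * y ^ 2| := by
        rw [gauss]; congr 1; ring
    _ ≤ _ := this
    _ = _ := by ring

/-- The cubic coefficient comes from `(1 - y²/2)(2y - 2y³/3) = 2y - 5y³/3 + y⁵/3`. The powers `5`
and `7` in the error lie between `4` and `8`, hence the shape of the bound. -/
lemma exists_norm_halfInt_sub_le : ∃ K : ℝ, 0 ≤ K ∧ ∀ y : ℝ,
    ‖halfInt y - Complex.I * ((2 * y - 5 / 3 * y ^ 3 : ℝ) : ℂ)‖ ≤ K * (|y| ^ 4 + |y| ^ 8) := by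
  set m := ∫ x, x ^ 4 * gauss x with hm
  have hm0 : 0 ≤ m := integral_nonneg fun x => by have := gauss_nonneg x; positivity
  refine ⟨3 * m + 10, by positivity, fun y => ?_⟩
  rw [halfInt_eq, ← mul_sub, norm_mul, Complex.norm_I, one_mul, ← Complex.ofReal_sub,
    Complex.norm_real, Real.norm_eq_abs]
  have e : gauss y * sinInt y - (2 * y - 5 / 3 * y ^ 3) =
      gauss y * (sinInt y - (2 * y - 2 / 3 * y ^ 3)) +
      (gauss y - (1 - y ^ 2 / 2)) * (2 * y - 2 / 3 * y ^ 3) + y ^ 5 / 3 := by ring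
  have h1 := abs_sinInt_sub_le y
  have h2 := abs_gauss_sub_le y
  have h4 : y ^ 4 = |y| ^ 4 := by rw [← abs_pow, abs_of_nonneg (by positivity)]
  rw [h4] at h1 h2
  have b1 : |gauss y * (sinInt y - (2 * y - 2 / 3 * y ^ 3))| ≤ 3 * m * |y| ^ 4 := by
    rw [abs_mul, abs_of_nonneg (gauss_nonneg y)]
    exact (mul_le_of_le_one_left (abs_nonneg _) (gauss_le_one y)).trans h1
  have b2 : |(gauss y - (1 - y ^ 2 / 2)) * (2 * y - 2 / 3 * y ^ 3)| ≤
      3 / 4 * |y| ^ 4 * (2 * |y| + 2 / 3 * |y| ^ 3) := by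
    rw [abs_mul]
    gcongr
    refine (abs_sub _ _).trans (le_of_eq ?_)
    rw [abs_mul, abs_mul, abs_pow]
    norm_num
  have b3 : |y ^ 5 / 3| = |y| ^ 5 / 3 := by rw [abs_div, abs_pow]; norm_num
  set u := |y| with hu
  have hu0 : 0 ≤ u := abs_nonneg y
  have p5 : u ^ 5 ≤ u ^ 4 + u ^ 8 := by
    rcases le_total u 1 with h | h
    · have := pow_le_pow_of_le_one hu0 h (show 4 ≤ 5 by norm_num)
      have : 0 ≤ u ^ 8 := by positivity
      linarith
    · have := pow_le_pow_right₀ h (show 5 ≤ 8 by norm_num)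
      have : 0 ≤ u ^ 4 := by positivity
      linarith
  have p7 : u ^ 7 ≤ u ^ 4 + u ^ 8 := by
    rcases le_total u 1 with h | h
    · have := pow_le_pow_of_le_one hu0 h (show 4 ≤ 7 by norm_num)
      have : 0 ≤ u ^ 8 := by positivity
      linarith
    · have := pow_le_pow_right₀ h (show 7 ≤ 8 by norm_num)
      have : 0 ≤ u ^ 4 := by positivity
      linarith
  rw [e]
  refine (abs_add_three _ _ _).trans ?_
  rw [b3]
  have p8 : 0 ≤ m * u ^ 8 := by positivity
  have p9 : 0 ≤ u ^ 8 := by positivity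
  have p10 : 0 ≤ u ^ 4 := by positivity
  nlinarith

/-- Expansion of the primitive of `halfInt`. -/
lemma exists_norm_integral_halfInt_sub_le : ∃ K : ℝ, 0 ≤ K ∧ ∀ a : ℝ,
    ‖(∫ y in (0 : ℝ)..a, halfInt y) - Complex.I * ((a : ℂ) ^ 2 - 5 / 12 * (a : ℂ) ^ 4)‖ ≤
      K * (|a| ^ 4 + |a| ^ 8) * |a| := by
  obtain ⟨K, hK, h⟩ := exists_norm_halfInt_sub_le
  refine ⟨K, hK, fun a => ?_⟩
  have hF : ∀ y : ℝ, HasDerivAt (fun y : ℝ => Complex.I * ((y : ℂ) ^ 2 - 5 / 12 * (y : ℂ) ^ 4))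
      (Complex.I * ((2 * y - 5 / 3 * y ^ 3 : ℝ) : ℂ)) y := fun y => by
    have h1 : HasDerivAt (fun z : ℂ => Complex.I * (z ^ 2 - 5 / 12 * z ^ 4))
        (Complex.I * ((2 * y - 5 / 3 * y ^ 3 : ℝ) : ℂ)) (y : ℂ) := by
      refine (((hasDerivAt_pow 2 (y : ℂ)).sub
        ((hasDerivAt_pow 4 (y : ℂ)).const_mul _)).const_mul _).congr_deriv ?_
      push_cast
      ring
    exact h1.comp_ofReal
  have hcont : Continuous fun y : ℝ => Complex.I * ((2 * y - 5 / 3 * y ^ 3 : ℝ) : ℂ) := by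
    fun_prop
  have hI := intervalIntegral.integral_eq_sub_of_hasDerivAt (a := 0) (b := a) (fun y _ => hF y)
    (hcont.intervalIntegrable 0 a)
  have hI' : Complex.I * ((a : ℂ) ^ 2 - 5 / 12 * (a : ℂ) ^ 4) =
      ∫ y in (0 : ℝ)..a, Complex.I * ((2 * y - 5 / 3 * y ^ 3 : ℝ) : ℂ) := by
    rw [hI]; simp
  rw [hI', ← intervalIntegral.integral_sub integrable_halfInt.intervalIntegrable
    (hcont.intervalIntegrable 0 a)]
  have := intervalIntegral.norm_integral_le_of_norm_le_const (a := 0) (b := a)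
    (f := fun y => halfInt y - Complex.I * ((2 * y - 5 / 3 * y ^ 3 : ℝ) : ℂ))
    (C := K * (|a| ^ 4 + |a| ^ 8)) fun y hy => by
      have hya : |y| ≤ |a| := by
        have := abs_sub_left_of_mem_uIcc (uIoc_subset_uIcc hy)
        simpa using this
      refine (h y).trans ?_
      gcongr
  rwa [sub_zero] at this

lemma norm_ker2_sub_le (x y : ℝ) :
    ‖ker2 x y - (1 - ((x : ℂ) ^ 2 + y ^ 2) / 2 + Complex.I * (x * y))‖ ≤
      3 * (x ^ 2 + y ^ 2) ^ 2 := by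
  set w : ℂ := -((x : ℂ) ^ 2 + y ^ 2) / 2 + Complex.I * (x * y) with hw
  have hw' : w = ((-(x ^ 2 + y ^ 2) / 2 : ℝ) : ℂ) + ((x * y : ℝ) : ℂ) * Complex.I := by
    rw [hw]; push_cast; ring
  have hre : w.re ≤ 0 := by
    rw [hw', Complex.add_re, Complex.re_ofReal_mul, Complex.ofReal_re, Complex.I_re]
    nlinarith [sq_nonneg x, sq_nonneg y]
  have h := norm_exp_sub_one_sub_le hre
  have hn : ‖w‖ ≤ x ^ 2 + y ^ 2 := by
    rw [hw']
    refine (norm_add_le _ _).trans ?_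
    rw [norm_mul, Complex.norm_I, mul_one, Complex.norm_real, Complex.norm_real, Real.norm_eq_abs,
      Real.norm_eq_abs, abs_div, abs_neg, abs_of_nonneg (by positivity : 0 ≤ x ^ 2 + y ^ 2),
      abs_of_pos (by norm_num : (0 : ℝ) < 2), abs_mul]
    nlinarith [sq_nonneg (|x| - |y|), sq_abs x, sq_abs y]
  have e : ker2 x y - (1 - ((x : ℂ) ^ 2 + y ^ 2) / 2 + Complex.I * (x * y)) =
      Complex.exp w - 1 - w := by
    rw [ker2_eq, ← hw]; simp only [hw]; ring
  rw [e]
  calc _ ≤ 3 * ‖w‖ ^ 2 := h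
    _ ≤ _ := by gcongr

/-- Expansion of the integral of the kernel over a rectangle. -/
lemma norm_integral_segInt_sub_le (a b : ℝ) :
    ‖(∫ y in (0 : ℝ)..b, segInt a y) - ((a : ℂ) * b - ((a : ℂ) ^ 3 * b + a * (b : ℂ) ^ 3) / 6 +
      Complex.I * (a : ℂ) ^ 2 * (b : ℂ) ^ 2 / 4)‖ ≤ 3 * (a ^ 2 + b ^ 2) ^ 2 * |a| * |b| := by
  have hx : ∀ y : ℝ, ‖segInt a y - ((a : ℂ) - (a ^ 3 / 3 + a * (y : ℂ) ^ 2) / 2 +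
      Complex.I * a ^ 2 / 2 * y)‖ ≤ 3 * (a ^ 2 + y ^ 2) ^ 2 * |a| := by
    intro y
    have hF : ∀ x : ℝ, HasDerivAt (fun x : ℝ => ((x : ℂ) - ((x : ℂ) ^ 3 / 3 + x * (y : ℂ) ^ 2) / 2 +
        Complex.I * (x : ℂ) ^ 2 / 2 * y))
        (1 - ((x : ℂ) ^ 2 + y ^ 2) / 2 + Complex.I * (x * y)) x := fun x => by
      have h1 : HasDerivAt (fun z : ℂ => (z - (z ^ 3 / 3 + z * (y : ℂ) ^ 2) / 2 +
          Complex.I * z ^ 2 / 2 * y)) (1 - ((x : ℂ) ^ 2 + y ^ 2) / 2 + Complex.I * (x * y))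
          (x : ℂ) := by
        refine (((hasDerivAt_id (x : ℂ)).sub ((((hasDerivAt_pow 3 (x : ℂ)).div_const 3).add
          ((hasDerivAt_id (x : ℂ)).mul_const _)).div_const 2)).add
          ((((hasDerivAt_pow 2 (x : ℂ)).const_mul _).div_const 2).mul_const _)).congr_deriv ?_
        push_cast
        ring
      exact h1.comp_ofReal
    have hcont : Continuous fun x : ℝ => (1 - ((x : ℂ) ^ 2 + y ^ 2) / 2 + Complex.I * (x * y)) := by
      fun_prop
    have hI := intervalIntegral.integral_eq_sub_of_hasDerivAt (a := 0) (b := a) (fun x _ => hF x)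
      (hcont.intervalIntegrable 0 a)
    have hI' : ((a : ℂ) - (a ^ 3 / 3 + a * (y : ℂ) ^ 2) / 2 + Complex.I * a ^ 2 / 2 * y) =
        ∫ x in (0 : ℝ)..a, (1 - ((x : ℂ) ^ 2 + y ^ 2) / 2 + Complex.I * (x * y)) := by
      rw [hI]; simp
    rw [hI', segInt, ← intervalIntegral.integral_sub (integrable_ker2_left y).intervalIntegrable
      (hcont.intervalIntegrable 0 a)]
    have := intervalIntegral.norm_integral_le_of_norm_le_const (a := 0) (b := a)
      (f := fun x => ker2 x y - (1 - ((x : ℂ) ^ 2 + y ^ 2) / 2 + Complex.I * (x * y)))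
      (C := 3 * (a ^ 2 + y ^ 2) ^ 2) fun x hx => by
        have hxa : |x| ≤ |a| := by
          have := abs_sub_left_of_mem_uIcc (uIoc_subset_uIcc hx)
          simpa using this
        have : x ^ 2 ≤ a ^ 2 := sq_le_sq.2 hxa
        refine (norm_ker2_sub_le x y).trans ?_
        gcongr
    rwa [sub_zero] at this
  have hF : ∀ y : ℝ, HasDerivAt (fun y : ℝ => ((a : ℂ) * y - ((a : ℂ) ^ 3 * y + a * (y : ℂ) ^ 3) / 6
      + Complex.I * (a : ℂ) ^ 2 * (y : ℂ) ^ 2 / 4))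
      ((a : ℂ) - (a ^ 3 / 3 + a * (y : ℂ) ^ 2) / 2 + Complex.I * a ^ 2 / 2 * y) y := fun y => by
    have h1 : HasDerivAt (fun z : ℂ => ((a : ℂ) * z - ((a : ℂ) ^ 3 * z + a * z ^ 3) / 6
        + Complex.I * (a : ℂ) ^ 2 * z ^ 2 / 4))
        ((a : ℂ) - (a ^ 3 / 3 + a * (y : ℂ) ^ 2) / 2 + Complex.I * a ^ 2 / 2 * y) (y : ℂ) := by
      refine ((((hasDerivAt_id (y : ℂ)).const_mul _).sub
        ((((hasDerivAt_id (y : ℂ)).const_mul _).add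
          ((hasDerivAt_pow 3 (y : ℂ)).const_mul _)).div_const 6)).add
          (((hasDerivAt_pow 2 (y : ℂ)).const_mul _).div_const 4)).congr_deriv ?_
      push_cast
      ring
    exact h1.comp_ofReal
  have hcont : Continuous fun y : ℝ =>
      ((a : ℂ) - (a ^ 3 / 3 + a * (y : ℂ) ^ 2) / 2 + Complex.I * a ^ 2 / 2 * y) := by fun_prop
  have hI := intervalIntegral.integral_eq_sub_of_hasDerivAt (a := 0) (b := b) (fun y _ => hF y)
    (hcont.intervalIntegrable 0 b)
  have hI' : ((a : ℂ) * b - ((a : ℂ) ^ 3 * b + a * (b : ℂ) ^ 3) / 6 +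
      Complex.I * (a : ℂ) ^ 2 * (b : ℂ) ^ 2 / 4) = ∫ y in (0 : ℝ)..b,
        ((a : ℂ) - (a ^ 3 / 3 + a * (y : ℂ) ^ 2) / 2 + Complex.I * a ^ 2 / 2 * y) := by
    rw [hI]; simp
  rw [hI', ← intervalIntegral.integral_sub (integrable_segInt a).intervalIntegrable
    (hcont.intervalIntegrable 0 b)]
  have := intervalIntegral.norm_integral_le_of_norm_le_const (a := 0) (b := b)
    (f := fun y => segInt a y -
      ((a : ℂ) - (a ^ 3 / 3 + a * (y : ℂ) ^ 2) / 2 + Complex.I * a ^ 2 / 2 * y))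
    (C := 3 * (a ^ 2 + b ^ 2) ^ 2 * |a|) fun y hy => by
      have hyb : |y| ≤ |b| := by
        have := abs_sub_left_of_mem_uIcc (uIoc_subset_uIcc hy)
        simpa using this
      have : y ^ 2 ≤ b ^ 2 := sq_le_sq.2 hyb
      refine (hx y).trans ?_
      gcongr
  rwa [sub_zero] at this

/-! ### The fourth order expansion of `H η i` -/

/-- The part of order at most four of the expansion of `signInt`. -/
def signIntMain (a b : ℂ) : ℂ :=
  (-2 * Complex.I * (a ^ 2 + b ^ 2) + 4 * (a * b)) +
    (5 * Complex.I / 6 * (a ^ 4 + b ^ 4) - 2 / 3 * (a ^ 3 * b + a * b ^ 3) +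
      Complex.I * (a ^ 2 * b ^ 2))

lemma exists_norm_signInt_sub_le : ∃ K : ℝ, 0 ≤ K ∧ ∀ a b : ℝ,
    ‖signInt a b - signInt 0 0 - signIntMain a b‖ ≤
      K * ((|a| ^ 4 + |a| ^ 8) * |a| + (|b| ^ 4 + |b| ^ 8) * |b| +
        (a ^ 2 + b ^ 2) ^ 2 * |a| * |b|) := by
  obtain ⟨K, hK, h⟩ := exists_norm_integral_halfInt_sub_le
  refine ⟨2 * K + 12, by positivity, fun a b => ?_⟩
  have h1 := h a
  have h2 := h b
  have h3 := norm_integral_segInt_sub_le a b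
  set A := (∫ y in (0 : ℝ)..a, halfInt y) - Complex.I * ((a : ℂ) ^ 2 - 5 / 12 * (a : ℂ) ^ 4)
  set B := (∫ y in (0 : ℝ)..b, halfInt y) - Complex.I * ((b : ℂ) ^ 2 - 5 / 12 * (b : ℂ) ^ 4)
  set D := (∫ y in (0 : ℝ)..b, segInt a y) - ((a : ℂ) * b - ((a : ℂ) ^ 3 * b + a * (b : ℂ) ^ 3) / 6 +
      Complex.I * (a : ℂ) ^ 2 * (b : ℂ) ^ 2 / 4)
  have e : signInt a b - signInt 0 0 - signIntMain a b = -2 * A + -2 * B + 4 * D := by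
    rw [signInt_eq a b, signIntMain]
    ring
  rw [e]
  refine norm_add₃_le.trans ?_
  rw [norm_mul, norm_mul, norm_mul, norm_neg, Complex.norm_ofNat, Complex.norm_ofNat]
  have p1 : 0 ≤ (|a| ^ 4 + |a| ^ 8) * |a| := by positivity
  have p2 : 0 ≤ (|b| ^ 4 + |b| ^ 8) * |b| := by positivity
  have p3 : 0 ≤ (a ^ 2 + b ^ 2) ^ 2 * |a| * |b| := by positivity
  nlinarith [mul_nonneg hK p3]

/-- The growth of the error term in the expansion of `signInt`. -/
def errGrowth (u : ℝ) : ℝ := (1 + u ^ 2) * (u ^ 4 + u ^ 8) + 2 * u ^ 6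

lemma errGrowth_nonneg (u : ℝ) : 0 ≤ errGrowth u := by unfold errGrowth; positivity

/-- The error is separated into a factor `ε⁵` and genuine polynomials in `u` and `v`, free of
absolute values, so that integrability against the kernel follows from the polynomial case. -/
lemma exists_norm_signInt_scaled_sub_le : ∃ K : ℝ, 0 ≤ K ∧ ∀ ε : ℝ, 0 ≤ ε → ε ≤ 1 → ∀ u v : ℝ,
    ‖signInt (ε * u) (ε * v) - signInt 0 0 - signIntMain (ε * u) (ε * v)‖ ≤
      K * ε ^ 5 * (errGrowth u + errGrowth v) := by
  obtain ⟨K, hK, h⟩ := exists_norm_signInt_sub_le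
  refine ⟨K, hK, fun ε h0 h1 u v => ?_⟩
  have := h (ε * u) (ε * v)
  push_cast at this
  refine this.trans ?_
  rw [mul_assoc K]
  refine mul_le_mul_of_nonneg_left ?_ hK
  have habs : ∀ w : ℝ, |w| ≤ 1 + w ^ 2 := fun w => by
    nlinarith [sq_nonneg (|w| - 1), sq_abs w, abs_nonneg w]
  have e4 : ∀ w : ℝ, |w| ^ 4 = w ^ 4 := fun w => by
    rw [← abs_pow, abs_of_nonneg (by positivity)]
  have e8 : ∀ w : ℝ, |w| ^ 8 = w ^ 8 := fun w => by
    rw [← abs_pow, abs_of_nonneg (by positivity)]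
  have h9 : ε ^ 9 ≤ ε ^ 5 := pow_le_pow_of_le_one h0 h1 (by norm_num)
  have h6 : ε ^ 6 ≤ ε ^ 5 := pow_le_pow_of_le_one h0 h1 (by norm_num)
  have hone : ∀ w : ℝ, (|ε * w| ^ 4 + |ε * w| ^ 8) * |ε * w| ≤
      ε ^ 5 * ((1 + w ^ 2) * (w ^ 4 + w ^ 8)) := by
    intro w
    rw [e4, e8, abs_mul, abs_of_nonneg h0]
    calc _ = (ε ^ 5 * w ^ 4 + ε ^ 9 * w ^ 8) * |w| := by ring
      _ ≤ (ε ^ 5 * w ^ 4 + ε ^ 5 * w ^ 8) * (1 + w ^ 2) := by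
        gcongr
        exact habs w
      _ = _ := by ring
  have htwo : ((ε * u) ^ 2 + (ε * v) ^ 2) ^ 2 * |ε * u| * |ε * v| ≤
      ε ^ 5 * (2 * u ^ 6 + 2 * v ^ 6) := by
    have huv : |u| * |v| ≤ (u ^ 2 + v ^ 2) / 2 := by
      nlinarith [sq_nonneg (|u| - |v|), sq_abs u, sq_abs v]
    have hcube : (u ^ 2 + v ^ 2) ^ 3 ≤ 4 * (u ^ 6 + v ^ 6) := by
      have : 0 ≤ 3 * (u ^ 2 + v ^ 2) * (u ^ 2 - v ^ 2) ^ 2 := by positivity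
      nlinarith
    rw [abs_mul, abs_mul, abs_of_nonneg h0]
    calc _ = ε ^ 6 * ((u ^ 2 + v ^ 2) ^ 2 * (|u| * |v|)) := by ring
      _ ≤ ε ^ 5 * ((u ^ 2 + v ^ 2) ^ 2 * ((u ^ 2 + v ^ 2) / 2)) := by gcongr
      _ = ε ^ 5 * ((u ^ 2 + v ^ 2) ^ 3 / 2) := by ring
      _ ≤ ε ^ 5 * (4 * (u ^ 6 + v ^ 6) / 2) := by gcongr
      _ = _ := by ring
  have := hone u
  have := hone v
  unfold errGrowth
  nlinarith

/-- The real polynomial function of `hermPoly`. -/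
def hermFun (x : ℝ) : ℝ := 4 * x ^ 5 - 20 * x ^ 3 + 15 * x

lemma eval_hermPoly (x : ℝ) : hermPoly.eval (x : ℂ) = (hermFun x : ℂ) := by
  simp [hermPoly, hermFun]

/-- The normalising factor of `h5`. -/
def hermNorm : ℝ := 1 / (2 * Real.pi ^ (1 / 4 : ℝ) * √15)

lemma hermNorm_pos : 0 < hermNorm := by
  have := Real.pi_pos
  unfold hermNorm
  positivity

lemma h5_eq (x : ℝ) : h5 x = hermNorm * hermFun x := by
  rw [h5, hermNorm, hermFun]; ring

lemma I_mem_strip : Complex.I ∈ strip := by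
  change |Complex.I.re| < 1
  simp

lemma kern_I_pairUp (r) : kern Complex.I (pairUp r) = ker2 r.1.1 r.1.2 * ker2 r.2.1 r.2.2 := by
  rw [kern, ker2_eq, ker2_eq, ← Complex.exp_add, Complex.I_sq]
  congr 1
  push_cast [pairUp]
  ring

lemma signProd_pairUp (η : ℝ) (r) : signProd η (pairUp r) =
    sgn (r.2.1 - η * h5 r.1.1) * sgn (r.2.2 - η * h5 r.1.2) := by
  simp only [signProd, signAbove, pairUp, sgn, sub_nonneg]
  congr

lemma integrand_pairUp (η : ℝ) (r) :
    (signProd η (pairUp r) : ℂ) * kern Complex.I (pairUp r) = ker2 r.1.1 r.1.2 *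
      ((sgn (r.2.1 - η * h5 r.1.1) * sgn (r.2.2 - η * h5 r.1.2)) • ker2 r.2.1 r.2.2) := by
  rw [kern_I_pairUp, signProd_pairUp, Complex.real_smul]
  ring

lemma integrable_integrand_pairUp (η : ℝ) :
    Integrable (fun r : (ℝ × ℝ) × (ℝ × ℝ) => ker2 r.1.1 r.1.2 *
      ((sgn (r.2.1 - η * h5 r.1.1) * sgn (r.2.2 - η * h5 r.1.2)) • ker2 r.2.1 r.2.2)) := by
  simp_rw [← integrand_pairUp]
  exact integrable_pairUp (integrable_signProd_mul_kern η I_mem_strip)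

lemma integrable_ker2_mul_signInt (η : ℝ) : Integrable fun r : ℝ × ℝ =>
    ker2 r.1 r.2 * signInt (η * h5 r.1) (η * h5 r.2) := by
  refine (integrable_integrand_pairUp η).integral_prod_left.congr
    (Eventually.of_forall fun r => ?_)
  simp only [signInt]
  rw [integral_const_mul]

/-- For fixed first coordinates the second coordinates see only two jumps, at `η h5 x₁` and `η h5
y₁`; their integral is `signInt`. -/
lemma H_I_eq (η : ℝ) : H η Complex.I = 1 / (4 * (Real.pi : ℂ)) *
    ∫ r : ℝ × ℝ, ker2 r.1 r.2 * signInt (η * h5 r.1) (η * h5 r.2) := by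
  rw [H_eq, ← integral_pairUp, Complex.I_sq]
  congr 1
  · congr 1; ring
  simp_rw [integrand_pairUp]
  rw [Measure.volume_eq_prod, integral_prod _ (integrable_integrand_pairUp η)]
  congr 1
  ext r
  simp only [signInt]
  rw [integral_const_mul]

/-- The value of the main part of the expansion. -/
lemma integral_ker2_mul_signIntMain (ε : ℝ) :
    Integrable (fun r : ℝ × ℝ =>
      ker2 r.1 r.2 * signIntMain (ε * hermFun r.1) (ε * hermFun r.2)) ∧
    ∫ r : ℝ × ℝ, ker2 r.1 r.2 * signIntMain (ε * hermFun r.1) (ε * hermFun r.2) =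
      ε ^ 4 * (Complex.I * ((√(2 * Real.pi) * (5760000 * √Real.pi) : ℝ) : ℂ)) := by
  set g : ℂ[X] → ℂ[X] → ℝ × ℝ → ℂ := fun p q r =>
    p.eval (r.1 : ℂ) * q.eval (r.2 : ℂ) * ker2 r.1 r.2 with hg
  have hi : ∀ p q, Integrable (g p q) := integrable_eval_eval_mul_ker2
  set P := hermPoly
  have k1 : Integrable fun r => -2 * Complex.I * (g (P ^ 2) 1 r + g 1 (P ^ 2) r) :=
    ((hi (P ^ 2) 1).add (hi 1 (P ^ 2))).const_mul _
  have k2 : Integrable fun r => 4 * g P P r := (hi P P).const_mul 4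
  have j1 : Integrable fun r => 5 * Complex.I / 6 * (g (P ^ 4) 1 r + g 1 (P ^ 4) r) :=
    ((hi (P ^ 4) 1).add (hi 1 (P ^ 4))).const_mul _
  have j2 : Integrable fun r => (2 / 3 : ℂ) * (g (P ^ 3) P r + g P (P ^ 3) r) :=
    ((hi (P ^ 3) P).add (hi P (P ^ 3))).const_mul _
  have j12 : Integrable fun r => 5 * Complex.I / 6 * (g (P ^ 4) 1 r + g 1 (P ^ 4) r) -
      (2 / 3 : ℂ) * (g (P ^ 3) P r + g P (P ^ 3) r) := j1.sub j2
  have j3 : Integrable fun r => Complex.I * g (P ^ 2) (P ^ 2) r :=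
    (hi (P ^ 2) (P ^ 2)).const_mul _
  have i1 : Integrable fun r => (ε : ℂ) ^ 2 *
      (-2 * Complex.I * (g (P ^ 2) 1 r + g 1 (P ^ 2) r) + 4 * g P P r) :=
    (k1.add k2).const_mul _
  have i2 : Integrable fun r => (ε : ℂ) ^ 4 *
      (5 * Complex.I / 6 * (g (P ^ 4) 1 r + g 1 (P ^ 4) r) -
        2 / 3 * (g (P ^ 3) P r + g P (P ^ 3) r) + Complex.I * g (P ^ 2) (P ^ 2) r) :=
    (j12.add j3).const_mul _
  have e : (fun r : ℝ × ℝ => ker2 r.1 r.2 * signIntMain (ε * hermFun r.1) (ε * hermFun r.2)) =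
      fun r => (ε : ℂ) ^ 2 * (-2 * Complex.I * (g (P ^ 2) 1 r + g 1 (P ^ 2) r) + 4 * g P P r) +
        (ε : ℂ) ^ 4 * (5 * Complex.I / 6 * (g (P ^ 4) 1 r + g 1 (P ^ 4) r) -
          2 / 3 * (g (P ^ 3) P r + g P (P ^ 3) r) + Complex.I * g (P ^ 2) (P ^ 2) r) := by
    ext r
    simp only [hg, signIntMain, eval_pow, eval_one, P, eval_hermPoly]
    ring
  rw [e]
  refine ⟨i1.add i2, ?_⟩
  have c1 : ∫ r, (-2 * Complex.I * (g (P ^ 2) 1 r + g 1 (P ^ 2) r) + 4 * g P P r) = 0 := by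
    rw [integral_add k1 k2, integral_const_mul, integral_const_mul, integral_add (hi _ _) (hi _ _)]
    exact kerForm_second_order
  have c2 : ∫ r, (5 * Complex.I / 6 * (g (P ^ 4) 1 r + g 1 (P ^ 4) r) -
      2 / 3 * (g (P ^ 3) P r + g P (P ^ 3) r) + Complex.I * g (P ^ 2) (P ^ 2) r) =
      Complex.I * ((√(2 * Real.pi) * (5760000 * √Real.pi) : ℝ) : ℂ) := by
    rw [integral_add j12 j3, integral_sub j1 j2,
      integral_const_mul, integral_const_mul, integral_const_mul, integral_add (hi _ _) (hi _ _),
      integral_add (hi _ _) (hi _ _)]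
    exact kerForm_fourth_order
  rw [integral_add i1 i2, integral_const_mul, integral_const_mul, c1, c2, mul_zero, zero_add]

lemma integrable_errGrowth : Integrable fun r : ℝ × ℝ =>
    (errGrowth (hermFun r.1) + errGrowth (hermFun r.2)) * ‖ker2 r.1 r.2‖ := by
  set p : ℂ[X] := (1 + hermPoly ^ 2) * (hermPoly ^ 4 + hermPoly ^ 8) + 2 * hermPoly ^ 6 with hp
  have he : ∀ x : ℝ, p.eval (x : ℂ) = (errGrowth (hermFun x) : ℂ) := fun x => by
    simp only [hp, eval_add, eval_mul, eval_pow, eval_one, eval_ofNat, eval_hermPoly, errGrowth]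
    push_cast
    ring
  refine ((integrable_eval_eval_mul_ker2 p 1).norm.add
    (integrable_eval_eval_mul_ker2 1 p).norm).congr (Eventually.of_forall fun r => ?_)
  simp only [Pi.add_apply, he, eval_one, mul_one, one_mul, norm_mul, Complex.norm_real,
    Real.norm_of_nonneg (errGrowth_nonneg _)]
  ring

/-- Integrates the pointwise expansion of `signInt` against the kernel. The natural small parameter
is `η * hermNorm`, which absorbs the normalisation of `h5`. -/
lemma exists_H_I_expansion : ∃ K s : ℝ, 0 ≤ K ∧ 0 < s ∧ ∀ η : ℝ, 0 ≤ η * hermNorm →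
    η * hermNorm ≤ 1 →
    ‖4 * Real.pi * (H η Complex.I - H 0 Complex.I) - (η * hermNorm) ^ 4 * (Complex.I * s)‖ ≤
      K * (η * hermNorm) ^ 5 := by
  obtain ⟨K, hK, h⟩ := exists_norm_signInt_scaled_sub_le
  set N := ∫ r : ℝ × ℝ, (errGrowth (hermFun r.1) + errGrowth (hermFun r.2)) * ‖ker2 r.1 r.2‖ with hN
  have hN0 : 0 ≤ N := integral_nonneg fun r =>
    mul_nonneg (add_nonneg (errGrowth_nonneg _) (errGrowth_nonneg _)) (norm_nonneg _)
  have hpi := Real.pi_pos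
  refine ⟨K * N, √(2 * Real.pi) * (5760000 * √Real.pi), by positivity, by positivity,
    fun η hη0 hη1 => ?_⟩
  set ε := η * hermNorm with hε
  obtain ⟨hmi, hme⟩ := integral_ker2_mul_signIntMain ε
  have hh : ∀ x, η * h5 x = ε * hermFun x := fun x => by rw [h5_eq, hε]; ring
  have i1 := integrable_ker2_mul_signInt η
  have i0 := integrable_ker2_mul_signInt 0
  have hH : 4 * Real.pi * (H η Complex.I - H 0 Complex.I) =
      (∫ r : ℝ × ℝ, ker2 r.1 r.2 * signInt (η * h5 r.1) (η * h5 r.2)) -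
        ∫ r : ℝ × ℝ, ker2 r.1 r.2 * signInt (0 * h5 r.1) (0 * h5 r.2) := by
    rw [H_I_eq η, H_I_eq 0]
    have : (Real.pi : ℂ) ≠ 0 := by exact_mod_cast hpi.ne'
    field_simp
  have hcast : ((η : ℂ) * hermNorm) ^ 4 = (ε : ℂ) ^ 4 := by rw [hε]; push_cast; rfl
  have i10 : Integrable fun r : ℝ × ℝ => ker2 r.1 r.2 * signInt (η * h5 r.1) (η * h5 r.2) -
      ker2 r.1 r.2 * signInt (0 * h5 r.1) (0 * h5 r.2) := i1.sub i0
  rw [hH, hcast, ← hme, ← integral_sub i1 i0, ← integral_sub i10 hmi]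
  have hb : Integrable fun r : ℝ × ℝ => K * ε ^ 5 *
      ((errGrowth (hermFun r.1) + errGrowth (hermFun r.2)) * ‖ker2 r.1 r.2‖) :=
    integrable_errGrowth.const_mul _
  refine (norm_integral_le_of_norm_le hb (Eventually.of_forall fun r => ?_)).trans (le_of_eq ?_)
  · simp only [zero_mul]
    rw [← mul_sub, ← mul_sub, norm_mul, hh, hh, mul_comm]
    calc _ ≤ K * ε ^ 5 * (errGrowth (hermFun r.1) + errGrowth (hermFun r.2)) * ‖ker2 r.1 r.2‖ := by
          gcongr
          exact h ε hη0 hη1 _ _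
      _ = _ := by ring
  · rw [integral_const_mul]; ring

/-- Conjugation sends `i` to `-i`; as `H η` is odd and commutes with conjugation, the quotient is
fixed. -/
lemma H_I_div_I_real (η : ℝ) :
    H η Complex.I / Complex.I = (((H η Complex.I / Complex.I).re : ℝ) : ℂ) := by
  refine (Complex.conj_eq_iff_re.1 ?_).symm
  rw [map_div₀, ← H_conj, Complex.conj_I, H_neg, neg_div_neg_eq]

lemma H_zero_I : H 0 Complex.I = Complex.I * Real.log (1 + √2) := by
  set L := Real.log (1 + √2)
  have hsL : Real.sinh L = 1 := sinh_log_one_add_sqrt_two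
  have hL0 : 0 < L := Real.sinh_pos_iff.1 (by rw [hsL]; exact one_pos)
  have hL89 : L < 89 / 100 := Real.sinh_lt_sinh.1 (by rw [hsL]; exact one_lt_sinh)
  have hmem : Complex.I * L ∈ ball (0 : ℂ) 1 := by
    rw [mem_ball_zero_iff, norm_mul, Complex.norm_I, one_mul, Complex.norm_real,
      Real.norm_of_nonneg hL0.le]
    linarith
  have hsin : Complex.sin (Complex.I * L) = Complex.I := by
    rw [mul_comm, Complex.sin_mul_I, ← Complex.ofReal_sinh, hsL]; simp
  rw [← H_zero_sin hmem, hsin]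

/-- For small `η > 0`, the value `H η i / i` exceeds `log (1 + √2)`. -/
theorem exists_log_lt_H_I : ∃ η₀ : ℝ, 0 < η₀ ∧ η₀ ≤ 1 ∧ ∀ η ∈ Ioo (0 : ℝ) η₀,
    Real.log (1 + √2) < (H η Complex.I / Complex.I).re := by
  obtain ⟨K, s, hK, hs, h⟩ := exists_H_I_expansion
  have hc := hermNorm_pos
  -- The last bound gives `ε K < s`, so the positive term of order four beats the remainder; `K + 1`
  -- guards against `K = 0`.
  refine ⟨min 1 (min (1 / hermNorm) (s / (K + 1) / hermNorm)), by positivity, min_le_left _ _,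
    fun η hη => ?_⟩
  have h1 : η < 1 / hermNorm := hη.2.trans_le ((min_le_right _ _).trans (min_le_left _ _))
  have h2 : η < s / (K + 1) / hermNorm :=
    hη.2.trans_le ((min_le_right _ _).trans (min_le_right _ _))
  rw [lt_div_iff₀ hc] at h1 h2
  rw [lt_div_iff₀ (by positivity)] at h2
  set ε := η * hermNorm with hε
  have hε0 : 0 < ε := mul_pos hη.1 hc
  have hb := h η hε0.le h1.le
  rw [← Complex.ofReal_mul, ← hε, H_zero_I] at hb
  set ρ := 4 * Real.pi * (H η Complex.I - Complex.I * Real.log (1 + √2)) -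
    (ε : ℂ) ^ 4 * (Complex.I * s) with hρ
  have hpi : (0 : ℝ) < 4 * Real.pi := by have := Real.pi_pos; positivity
  have e : ((4 * Real.pi : ℝ) : ℂ) * (H η Complex.I / Complex.I) =
      ((4 * Real.pi * Real.log (1 + √2) + ε ^ 4 * s : ℝ) : ℂ) + ρ / Complex.I := by
    rw [hρ]
    push_cast
    field_simp
    ring
  have e2 := congrArg Complex.re e
  rw [Complex.re_ofReal_mul, Complex.add_re, Complex.ofReal_re] at e2
  have h3 : -(K * ε ^ 5) ≤ (ρ / Complex.I).re := by
    have := Complex.abs_re_le_norm (ρ / Complex.I)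
    rw [norm_div, Complex.norm_I, div_one] at this
    exact (abs_le.1 (this.trans hb)).1
  have h4 : K * ε ^ 5 < ε ^ 4 * s := by
    have : 0 < ε ^ 4 := by positivity
    calc K * ε ^ 5 = ε ^ 4 * (ε * K) := by ring
      _ < ε ^ 4 * s := by
        gcongr
        linarith
  have h5 : 4 * Real.pi * Real.log (1 + √2) < 4 * Real.pi * (H η Complex.I / Complex.I).re := by
    linarith
  exact lt_of_mul_lt_mul_left h5 hpi.le

end

end KrivineRounding

theorem theorem5p1 :
    ∃ η₀ : ℝ, 0 < η₀ ∧ η₀ ≤ 1 ∧ ∀ η ∈ Set.Ioo (0 : ℝ) η₀,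
      (∃ t : ℝ, KrivineRounding.H η Complex.I / Complex.I = (t : ℂ) ∧
        Real.log (1 + Real.sqrt 2) < t) ∧
      ∃ p₀ : ℝ, 0 < p₀ ∧ p₀ ≤ 1 ∧ ∀ p ∈ Set.Ioo (0 : ℝ) p₀,
        Metric.ball (0 : ℂ) (9 / 10) ⊆ KrivineRounding.F η p '' KrivineRounding.strip ∧
        ∃ (Ω : Set ℂ) (G : ℂ → ℂ),
          -- `G` is the inverse of `F_p` restricted to a region `Ω` around the origin
          IsOpen Ω ∧ Bornology.IsBounded Ω ∧ closure Ω ⊆ KrivineRounding.strip ∧ (0 : ℂ) ∈ Ω ∧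
          Set.BijOn (KrivineRounding.F η p) Ω (Metric.ball (0 : ℂ) (9 / 10)) ∧
          Set.InvOn G (KrivineRounding.F η p) Ω (Metric.ball (0 : ℂ) (9 / 10)) ∧
          G 0 = 0 ∧
          AnalyticOnNhd ℂ G (Metric.ball (0 : ℂ) (9 / 10)) ∧
          (∀ z ∈ Metric.ball (0 : ℂ) (9 / 10),
            HasSum (fun k : ℕ => KrivineRounding.taylorCoeff G (k + 1) * z ^ (k + 1)) (G z)) ∧
          ∃ γ : ℝ, 0 ≤ γ ∧
            HasSum (fun k : ℕ => ‖KrivineRounding.taylorCoeff G (k + 1)‖ * γ ^ (k + 1)) 1 ∧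
            Real.log (1 + Real.sqrt 2) < γ := by
  obtain ⟨η₀, h0, h1, h⟩ := KrivineRounding.exists_log_lt_H_I
  exact ⟨η₀, h0, h1, fun η hη => ⟨⟨_, KrivineRounding.H_I_div_I_real η, h η hη⟩,
    KrivineRounding.exists_inverse_and_root (KrivineRounding.H_I_div_I_real η) (h η hη)⟩⟩
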